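/- Let $N\ge 1$. To gains $\varepsilon=(\varepsilon_1,\dots,\varepsilon_{N-1})\in\mathbb R^{N-1}$ associate the control $$u_n=-\sum_{j=1}^{N-1}\varepsilon_j\bigl(f(x_{n-2j+2})-f(x_{n-2j})\bigr)$$ of the scalar system $x_{n+1}=f(x_n)$, and call $\varepsilon$ admissible if $|\varepsilon_j|<1$ for all $j$. With the conventions $\varepsilon_0=1$, $\varepsilon_N=0$, put $a_j=\varepsilon_{j-1}-\varepsilon_j$ for $1\le j\le N$ (that is, $a_1=1-\varepsilon_1$, $a_j=\varepsilon_{j-1}-\varepsilon_j$ for $2\le j\le N-1$, $a_N=\varepsilon_{N-1}$ when $N\ge2$, and $a_1=1$ when $N=1$). For $a=(a_1,\dots,a_N)$ let $\mu^*(a)\in[0,\infty]$ be the largest $m$ such that for every multiplier $\mu\in(-m,0)$ the characteristic equation of a $2$-cycle with multiplier $\mu$, $$\lambda-\mu\,\bigl(a_1+a_2\lambda^{-1}+\dots+a_N\lambda^{-(N-1)}\bigr)^2=0\qquad(\lambda\in\mathbb C\setminus\{0\}),$$ has no root with $|\lambda|>1$; thus $\mu^*(a)$ is the first value of $|\mu|$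 at which roots leave the unit disc. Let also $C(t)=\sum_{j=1}^N a_j\cos(2j-1)t$, $S(t)=\sum_{j=1}^N a_j\sin(2j-1)t$, let $T(a)$ be the set of points of $(0,\pi/2)$ at which $C$ changes sign, and $\rho(a)=\max\{|S(t)|:t\in T(a)\cup\{\pi/2\}\}$. Let $a_k^0=\dfrac{2(N-k)+1}{N^2}$ for $1\le k\le N$, and $$\varepsilon_j^0=\sum_{k=j+1}^N a_k^0,\qquad j=1,\dots,N-1.$$ Then: 1. For all $\varepsilon$, $f:\mathbb R\to\mathbb R$, $(x_n)_{n\in\mathbb Z}$ and $n$, one has $f(x_n)+u_n=\sum_{j=1}^N a_j f(x_{n-2j+2})$. 2. The map $\varepsilon\mapsto a$ is a bijection of $\mathbb R^{N-1}$ onto $\{a\in\mathbb R^N:\sum_{j=1}^N a_j=1\}$. 3. The optimal gains are uniquely determined and equal to $\varepsilon^0$: among admissible gains, $\mu^*(a(\varepsilon))$ is maximal exactly for $\varepsilon=\varepsilon^0$ (in particular $\varepsilon^0$ is admissible). 4. The same holds among all $\varepsilon\in\mathbb R^{N-1}$: $\mu^*(a(\varepsilon))$ is maximal exactly for $\varepsilon=\varepsilon^0$.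 5. Among all $\varepsilon\in\mathbb R^{N-1}$, $\rho(a(\varepsilon))$ is minimal exactly for $\varepsilon=\varepsilon^0$. -/

import Mathlib

open scoped NNReal ENNReal

noncomputable section

namespace CycleControl

/-- Gains `ε_1, …, ε_{N-1}`; `ε_j` is stored at the index `j - 1`. -/
abbrev Gains (N : ℕ) : Type := Fin (N - 1) → ℝ

/-- Coefficients `a_1, …, a_N`; `a_j` is stored at the index `j - 1`. -/
abbrev Coeffs (N : ℕ) : Type := Fin N → ℝ

/-- The delayed feedback control
`u_n = -∑_{j=1}^{N-1} ε_j (f (x_{n-2j+2}) - f (x_{n-2j}))`. -/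
def control (N : ℕ) (ε : Gains N) (f : ℝ → ℝ) (x : ℤ → ℝ) (n : ℤ) : ℝ :=
  -∑ j : Fin (N - 1), ε j *
    (f (x (n - 2 * ((j : ℤ) + 1) + 2)) - f (x (n - 2 * ((j : ℤ) + 1))))

/-- The admissible gains: `|ε_j| < 1` for all `j`. -/
def admissible (N : ℕ) : Set (Gains N) := {ε | ∀ j, |ε j| < 1}

/-- The gain `ε_j`, `1 ≤ j ≤ N - 1`, extended by `ε_0 = 1` and `ε_j = 0` for `j ≥ N`. -/
def extGain (N : ℕ) (ε : Gains N) (j : ℕ) : ℝ :=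
  if j = 0 then 1 else if h : j - 1 < N - 1 then ε ⟨j - 1, h⟩ else 0

/-- `a_1 = 1 - ε_1`, `a_j = ε_{j-1} - ε_j` for `2 ≤ j ≤ N - 1`, `a_N = ε_{N-1}`
(and `a_1 = 1` if `N = 1`). -/
def coeffs (N : ℕ) (ε : Gains N) : Coeffs N :=
  fun i => extGain N ε (i : ℕ) - extGain N ε ((i : ℕ) + 1)

/-- `z` is a root of the characteristic equation
`z - μ (a_1 + a_2 z⁻¹ + ⋯ + a_N z^{-(N-1)})² = 0` of a 2-cycle with multiplier `μ`. -/
def IsCharRoot (N : ℕ) (a : Coeffs N) (μ : ℝ) (z : ℂ) : Prop :=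
  z ≠ 0 ∧ z - (μ : ℂ) * (∑ i : Fin N, (a i : ℂ) * (z⁻¹) ^ (i : ℕ)) ^ 2 = 0

/-- `μ*(a)`: the largest `m` such that for no multiplier `μ ∈ (-m, 0)` does the characteristic
equation have a root outside the unit disc, i.e. the first value of `|μ|` at which
roots leave the disc. -/
def muStar (N : ℕ) (a : Coeffs N) : ℝ≥0∞ :=
  sSup {m : ℝ≥0∞ | ∀ μ : ℝ, μ < 0 → ENNReal.ofReal (-μ) < m →
    ∀ z : ℂ, IsCharRoot N a μ z → ‖z‖ ≤ 1}

/-- `C(t) = ∑_{j=1}^N a_j cos (2j-1)t`. -/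
def cosPoly (N : ℕ) (a : Coeffs N) (t : ℝ) : ℝ :=
  ∑ i : Fin N, a i * Real.cos ((2 * (i : ℝ) + 1) * t)

/-- `S(t) = ∑_{j=1}^N a_j sin (2j-1)t`. -/
def sinPoly (N : ℕ) (a : Coeffs N) (t : ℝ) : ℝ :=
  ∑ i : Fin N, a i * Real.sin ((2 * (i : ℝ) + 1) * t)

/-- The points of `(0, π/2)` at which `C` changes sign. -/
def signChanges (N : ℕ) (a : Coeffs N) : Set ℝ :=
  {t | t ∈ Set.Ioo 0 (Real.pi / 2) ∧ ∃ δ > 0,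
    (∀ s ∈ Set.Ioo (t - δ) t, ∀ s' ∈ Set.Ioo t (t + δ),
      cosPoly N a s * cosPoly N a s' < 0)}

/-- `max {|S(t)| : t ∈ T ∪ {π/2}}`, with `T` the (finite) set of sign changes of `C`
on `(0, π/2)`. -/
def rho (N : ℕ) (a : Coeffs N) : ℝ :=
  sSup ((fun t => |sinPoly N a t|) '' (signChanges N a ∪ {Real.pi / 2}))

/-- `a_k^0 = (2(N-k)+1)/N²`, with `k` counted from `1`. -/
def optCoeff (N k : ℕ) : ℝ := (2 * ((N : ℝ) - (k : ℝ)) + 1) / (N : ℝ) ^ 2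

/-- `ε_j = ∑_{k=j+1}^N a_k^0` for `j = 1, …, N-1`. -/
def optGains (N : ℕ) : Gains N :=
  fun i => ∑ k ∈ Finset.Icc (((i : ℕ) + 1) + 1) N, optCoeff N k

end CycleControl

end

namespace CycleControl

section Gains

theorem extGain_zero (N : ℕ) (ε : Gains N) : extGain N ε 0 = 1 := by simp [extGain]

theorem extGain_of_le {N : ℕ} (ε : Gains N) {j : ℕ} (hN : 1 ≤ N) (h : N ≤ j) :
    extGain N ε j = 0 := by
  have h1 : j ≠ 0 := by omega
  have h2 : ¬ (j - 1 < N - 1) := by omega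
  simp [extGain, h1, h2]

theorem extGain_succ {N : ℕ} (ε : Gains N) (j : Fin (N - 1)) :
    extGain N ε ((j : ℕ) + 1) = ε j := by
  simp [extGain]

/-- The closed loop, by summation by parts. -/
theorem add_control_eq (N : ℕ) (hN : 1 ≤ N) (ε : Gains N) (f : ℝ → ℝ) (x : ℤ → ℝ) (n : ℤ) :
    f (x n) + control N ε f x n =
      ∑ i : Fin N, coeffs N ε i * f (x (n - 2 * ((i : ℤ) + 1) + 2)) := by
  obtain ⟨M, rfl⟩ : ∃ M, N = M + 1 := ⟨N - 1, by omega⟩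
  set e := extGain (M + 1) ε with he
  set g : ℕ → ℝ := fun i => f (x (n - 2 * (i : ℤ))) with hg
  have h1 : control (M + 1) ε f x n =
      -∑ j ∈ Finset.range M, e (j + 1) * (g j - g (j + 1)) := by
    rw [← Fin.sum_univ_eq_sum_range (fun j => e (j + 1) * (g j - g (j + 1)))]
    unfold control
    congr 1
    refine Finset.sum_congr rfl fun j _ => ?_
    rw [he, extGain_succ]
    simp only [hg]
    push_cast
    ring_nf
  have h2 : ∑ i : Fin (M + 1), coeffs (M + 1) ε i * f (x (n - 2 * ((i : ℤ) + 1) + 2)) =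
      ∑ i ∈ Finset.range (M + 1), (e i - e (i + 1)) * g i := by
    rw [← Fin.sum_univ_eq_sum_range (fun i => (e i - e (i + 1)) * g i)]
    refine Finset.sum_congr rfl fun j _ => ?_
    simp only [coeffs, hg, he]
    ring_nf
  have h3 : ∀ K : ℕ, ∑ i ∈ Finset.range (K + 1), (e i - e (i + 1)) * g i =
      e 0 * g 0 - (∑ j ∈ Finset.range K, e (j + 1) * (g j - g (j + 1))) - e (K + 1) * g K := by
    intro K
    induction K with
    | zero => simp; ring
    | succ K ih => rw [Finset.sum_range_succ, ih, Finset.sum_range_succ _ K]; ring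
  have h4 : e (M + 1) = 0 := extGain_of_le ε hN le_rfl
  have h5 : e 0 = 1 := extGain_zero _ ε
  have h6 : g 0 = f (x n) := by simp [hg]
  rw [h1, h2, h3, h4, h5, h6]
  ring

theorem sum_coeffs_eq_one (N : ℕ) (hN : 1 ≤ N) (ε : Gains N) : ∑ i, coeffs N ε i = 1 := by
  unfold coeffs
  rw [Fin.sum_univ_eq_sum_range (fun i => extGain N ε i - extGain N ε (i + 1)),
    Finset.sum_range_sub', extGain_zero, extGain_of_le ε hN le_rfl, sub_zero]

theorem extGain_eq_sub_sum {N : ℕ} (ε : Gains N) {j : ℕ} (hj : j ≤ N) :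
    extGain N ε j = 1 - ∑ i : Fin j, coeffs N ε ⟨i, i.2.trans_le hj⟩ := by
  unfold coeffs
  rw [Fin.sum_univ_eq_sum_range (fun i => extGain N ε i - extGain N ε (i + 1)),
    Finset.sum_range_sub', extGain_zero]
  ring

theorem coeffs_injective (N : ℕ) : Function.Injective (coeffs N) := by
  intro ε ε' h
  funext j
  have hj : (j : ℕ) + 1 ≤ N := by have := j.2; omega
  rw [← extGain_succ ε j, ← extGain_succ ε' j, extGain_eq_sub_sum ε hj,
    extGain_eq_sub_sum ε' hj, h]

/-- A vector of gains has coefficients `a` as soon as its entries are the tails of `a`. -/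
theorem coeffs_eq_of_tails {N : ℕ} (b : ℕ → ℝ)
    (hb : ∑ k ∈ Finset.range N, b k = 1) (ε : Gains N)
    (hε : ∀ j : Fin (N - 1), ε j = ∑ k ∈ Finset.Ico ((j : ℕ) + 1) N, b k) (i : Fin N) :
    coeffs N ε i = b i := by
  have key : ∀ j ≤ N, extGain N ε j = ∑ k ∈ Finset.Ico j N, b k := by
    intro j hj
    rcases Nat.eq_zero_or_pos j with rfl | hpos
    · rw [extGain_zero, ← hb, Finset.range_eq_Ico]
    · rcases hj.eq_or_lt with rfl | hlt
      · simp [extGain_of_le ε hpos le_rfl]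
      · have h := extGain_succ ε ⟨j - 1, by omega⟩
        have h' := hε ⟨j - 1, by omega⟩
        simp only [Nat.sub_add_cancel hpos] at h h'
        rw [h, h']
  unfold coeffs
  rw [key _ i.2.le, key _ i.2, Finset.sum_eq_sum_Ico_succ_bot i.2]
  ring

theorem bijOn_coeffs (N : ℕ) (hN : 1 ≤ N) :
    Set.BijOn (coeffs N) Set.univ {a : Coeffs N | ∑ i, a i = 1} := by
  refine ⟨fun ε _ => sum_coeffs_eq_one N hN ε, (coeffs_injective N).injOn, fun a ha => ?_⟩
  set b : ℕ → ℝ := fun k => if h : k < N then a ⟨k, h⟩ else 0 with hbdef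
  have hba : ∀ i : Fin N, b i = a i := fun i => by simp [hbdef]
  refine ⟨fun j => ∑ k ∈ Finset.Ico ((j : ℕ) + 1) N, b k, trivial, ?_⟩
  funext i
  rw [coeffs_eq_of_tails b _ _ (fun _ => rfl), hba]
  rw [← Fin.sum_univ_eq_sum_range]
  simpa only [hba, Set.mem_ofPred_eq] using ha

theorem sum_range_optCoeff {N j : ℕ} (hN : 1 ≤ N) :
    ∑ k ∈ Finset.range j, optCoeff N (k + 1) = (2 * N * j - (j : ℝ) ^ 2) / (N : ℝ) ^ 2 := by
  have : (N : ℝ) ≠ 0 := by positivity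
  induction j with
  | zero => simp
  | succ j ih =>
    rw [Finset.sum_range_succ, ih, optCoeff]
    push_cast
    field_simp
    ring

theorem sum_optCoeff {N : ℕ} (hN : 1 ≤ N) : ∑ k ∈ Finset.range N, optCoeff N (k + 1) = 1 := by
  have : (N : ℝ) ≠ 0 := by positivity
  rw [sum_range_optCoeff hN]
  field_simp
  ring

theorem optGains_eq_sum (N : ℕ) (j : Fin (N - 1)) :
    optGains N j = ∑ k ∈ Finset.Ico ((j : ℕ) + 1) N, optCoeff N (k + 1) := by
  rw [optGains, Finset.sum_Ico_add' (fun k => optCoeff N k)]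
  rfl

theorem coeffs_optGains {N : ℕ} (hN : 1 ≤ N) (i : Fin N) :
    coeffs N (optGains N) i = optCoeff N ((i : ℕ) + 1) :=
  coeffs_eq_of_tails (fun k => optCoeff N (k + 1)) (sum_optCoeff hN) _ (optGains_eq_sum N) i

theorem optGains_eq {N : ℕ} (hN : 1 ≤ N) (j : Fin (N - 1)) :
    optGains N j = (1 - ((j : ℝ) + 1) / N) ^ 2 := by
  have hj : (j : ℕ) + 1 ≤ N := by have := j.2; omega
  have : (N : ℝ) ≠ 0 := by positivity
  rw [optGains_eq_sum, Finset.sum_Ico_eq_sub _ hj, sum_optCoeff hN, sum_range_optCoeff hN]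
  push_cast
  field_simp
  ring

theorem optGains_mem_admissible {N : ℕ} (hN : 1 ≤ N) : optGains N ∈ admissible N := by
  intro j
  have hj : ((j : ℕ) : ℝ) + 1 < N := by
    have := j.2
    exact_mod_cast (show (j : ℕ) + 1 < N by omega)
  have hN0 : (0 : ℝ) < N := by positivity
  have h1 : ((j : ℝ) + 1) / N < 1 := (div_lt_one hN0).2 hj
  have h2 : 0 < ((j : ℝ) + 1) / N := by positivity
  rw [optGains_eq hN, abs_of_nonneg (sq_nonneg _)]
  nlinarith

end Gains

section Trigonometry

open Real

/-- `sin t` times the divided difference at `cos² s`, `cos² t` of the polynomial `p` with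
`p (cos² s) = cos s * cos ((2i+1)s)`. -/
noncomputable def cosKernel (i : ℕ) (t s : ℝ) : ℝ :=
  sin ((2 * i + 1) * t) +
    2 * ∑ k ∈ Finset.range i, sin ((2 * i - 2 * k - 1) * t) * cos (2 * (k + 1) * s)

/-- The sine companion of `cosKernel`. -/
noncomputable def sinKernel (i : ℕ) (t s : ℝ) : ℝ :=
  2 * ∑ k ∈ Finset.range i, sin ((2 * i - 2 * k - 1) * t) * sin (2 * (k + 1) * s)

theorem cosKernel_succ (i : ℕ) (t s : ℝ) :
    cosKernel (i + 1) t s = sin ((2 * i + 1) * t + 2 * t) + sin ((2 * i + 1) * t) * cos (2 * s) +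
      cos (2 * s) * cosKernel i t s - sin (2 * s) * sinKernel i t s := by
  unfold cosKernel sinKernel
  rw [Finset.sum_range_succ']
  have h : ∀ k : ℕ, sin ((2 * ((i + 1 : ℕ) : ℝ) - 2 * ((k + 1 : ℕ) : ℝ) - 1) * t) *
      cos (2 * (((k + 1 : ℕ) : ℝ) + 1) * s) =
      cos (2 * s) * (sin ((2 * i - 2 * k - 1) * t) * cos (2 * (k + 1) * s)) -
      sin (2 * s) * (sin ((2 * i - 2 * k - 1) * t) * sin (2 * (k + 1) * s)) := by
    intro k
    rw [show (2 * (((k + 1 : ℕ) : ℝ) + 1) * s) = 2 * (k + 1) * s + 2 * s by push_cast; ring,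
      cos_add, show (2 * ((i + 1 : ℕ) : ℝ) - 2 * ((k + 1 : ℕ) : ℝ) - 1) * t =
        (2 * i - 2 * k - 1) * t by push_cast; ring]
    ring
  simp only [h, Finset.sum_sub_distrib, ← Finset.mul_sum]
  rw [show (2 * ((i + 1 : ℕ) : ℝ) + 1) * t = (2 * i + 1) * t + 2 * t by push_cast; ring,
    show (2 * ((i + 1 : ℕ) : ℝ) - 2 * ((0 : ℕ) : ℝ) - 1) * t = (2 * i + 1) * t by push_cast; ring,
    show (2 * (((0 : ℕ) : ℝ) + 1) * s) = 2 * s by push_cast; ring]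
  ring

theorem sinKernel_succ (i : ℕ) (t s : ℝ) :
    sinKernel (i + 1) t s = sin ((2 * i + 1) * t) * sin (2 * s) +
      cos (2 * s) * sinKernel i t s + sin (2 * s) * cosKernel i t s := by
  unfold cosKernel sinKernel
  rw [Finset.sum_range_succ']
  have h : ∀ k : ℕ, sin ((2 * ((i + 1 : ℕ) : ℝ) - 2 * ((k + 1 : ℕ) : ℝ) - 1) * t) *
      sin (2 * (((k + 1 : ℕ) : ℝ) + 1) * s) =
      cos (2 * s) * (sin ((2 * i - 2 * k - 1) * t) * sin (2 * (k + 1) * s)) +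
      sin (2 * s) * (sin ((2 * i - 2 * k - 1) * t) * cos (2 * (k + 1) * s)) := by
    intro k
    rw [show (2 * (((k + 1 : ℕ) : ℝ) + 1) * s) = 2 * (k + 1) * s + 2 * s by push_cast; ring,
      sin_add, show (2 * ((i + 1 : ℕ) : ℝ) - 2 * ((k + 1 : ℕ) : ℝ) - 1) * t =
        (2 * i - 2 * k - 1) * t by push_cast; ring]
    ring
  simp only [h, Finset.sum_add_distrib, ← Finset.mul_sum]
  rw [show (2 * ((i + 1 : ℕ) : ℝ) - 2 * ((0 : ℕ) : ℝ) - 1) * t = (2 * i + 1) * t by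
      push_cast; ring,
    show (2 * (((0 : ℕ) : ℝ) + 1) * s) = 2 * s by push_cast; ring]
  ring

theorem kernel_identities (i : ℕ) (t s : ℝ) :
    (cos s ^ 2 - cos t ^ 2) * cosKernel i t s =
        sin t * (cos s * cos ((2 * i + 1) * s) - cos t * cos ((2 * i + 1) * t)) ∧
    (cos s ^ 2 - cos t ^ 2) * sinKernel i t s =
        sin t * cos s * sin ((2 * i + 1) * s) - sin s * cos s * sin ((2 * i + 1) * t) := by
  induction i with
  | zero => constructor <;> simp [cosKernel, sinKernel] <;> ring
  | succ i ih =>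
    obtain ⟨hc, hs⟩ := ih
    have e : ∀ x : ℝ, (2 * ((i + 1 : ℕ) : ℝ) + 1) * x = (2 * i + 1) * x + 2 * x := by
      intro x; push_cast; ring
    rw [cosKernel_succ, sinKernel_succ]
    simp only [e, cos_add, sin_add]
    generalize cosKernel i t s = Kc at *
    generalize sinKernel i t s = Ks at *
    generalize (2 * (i : ℝ) + 1) * t = T at *
    generalize (2 * (i : ℝ) + 1) * s = S at *
    have h1 := sin_sq_add_cos_sq t
    have h2 := sin_sq_add_cos_sq s
    have h3 : sin t ^ 2 = 1 - cos t ^ 2 := by linarith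
    have h4 : sin s ^ 2 = 1 - cos s ^ 2 := by linarith
    simp only [cos_two_mul, sin_two_mul]
    constructor
    · linear_combination (2 * cos s ^ 2 - 1) * hc - 2 * sin s * cos s * hs + 2 * cos s ^ 2 * sin T * h4
        - 2 * cos t ^ 2 * sin T * h3
    · linear_combination (2 * cos s ^ 2 - 1) * hs + 2 * sin s * cos s * hc

theorem sum_cos_nodes {N k : ℕ} (hk : 0 < k) (hkN : k < N) :
    ∑ j ∈ Finset.range N, cos (2 * k * (π * j / N)) = 0 := by
  have hN : (N : ℝ) ≠ 0 := by have : N ≠ 0 := by omega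
                              exact_mod_cast this
  have hN0 : (0 : ℝ) < N := by have : 0 < N := by omega
                               exact_mod_cast this
  set φ : ℝ := π * k / N with hφ
  have hsin : 0 < sin φ := by
    apply sin_pos_of_pos_of_lt_pi
    · have : (0 : ℝ) < k := by exact_mod_cast hk
      have := pi_pos
      positivity
    · rw [hφ, div_lt_iff₀ hN0]
      have : (k : ℝ) < N := by exact_mod_cast hkN
      nlinarith [pi_pos]
  have key : ∀ n : ℕ, 2 * sin φ * ∑ j ∈ Finset.range n, cos (2 * k * (π * j / N)) =
      sin ((2 * n - 1) * φ) + sin φ := by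
    intro n
    induction n with
    | zero => simp
    | succ n ih =>
      rw [Finset.sum_range_succ, mul_add, ih,
        show (2 * ((n + 1 : ℕ) : ℝ) - 1) * φ = 2 * n * φ + φ by push_cast; ring,
        show (2 * (n : ℝ) - 1) * φ = 2 * n * φ - φ by ring,
        show 2 * (k : ℝ) * (π * n / N) = 2 * n * φ by rw [hφ]; ring, sin_add, sin_sub]
      ring
  have h := key N
  rw [show (2 * (N : ℝ) - 1) * φ = -φ + (k : ℕ) * (2 * π) by rw [hφ]; field_simp; ring,
    sin_add_nat_mul_two_pi, sin_neg, neg_add_cancel] at h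
  rcases mul_eq_zero.1 h with h | h
  · linarith
  · exact h

theorem sum_cosKernel_nodes {N i : ℕ} (hi : i < N) (t : ℝ) :
    ∑ j ∈ Finset.range N, cosKernel i t (π * j / N) = N * sin ((2 * i + 1) * t) := by
  unfold cosKernel
  rw [Finset.sum_add_distrib, ← Finset.mul_sum, Finset.sum_comm]
  have : ∀ k ∈ Finset.range i, ∑ j ∈ Finset.range N,
      sin ((2 * i - 2 * k - 1) * t) * cos (2 * ((k : ℝ) + 1) * (π * j / N)) = 0 := by
    intro k hk
    rw [← Finset.mul_sum]
    have := sum_cos_nodes (N := N) (k := k + 1) (by omega)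
      (by have := Finset.mem_range.1 hk; omega)
    push_cast at this
    rw [this, mul_zero]
  rw [Finset.sum_eq_zero this]
  simp

theorem two_sin_mul_sum_cos (N : ℕ) (t : ℝ) :
    2 * sin t * ∑ k ∈ Finset.range N, cos ((2 * k + 1) * t) = sin (2 * N * t) := by
  induction N with
  | zero => simp
  | succ n ih =>
    rw [Finset.sum_range_succ, mul_add, ih,
      show 2 * ((n + 1 : ℕ) : ℝ) * t = (2 * n + 1) * t + t by push_cast; ring,
      show 2 * (n : ℝ) * t = (2 * n + 1) * t - t by ring, sin_add, sin_sub]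
    ring

theorem sin_sq_mul_sum_cos (N : ℕ) (t : ℝ) :
    sin t ^ 2 * ∑ k ∈ Finset.range N, (2 * (N : ℝ) - 2 * k - 1) * cos ((2 * k + 1) * t) =
      cos t * sin (N * t) ^ 2 := by
  induction N with
  | zero => simp
  | succ n ih =>
    have h1 : ∑ k ∈ Finset.range (n + 1),
        (2 * ((n + 1 : ℕ) : ℝ) - 2 * k - 1) * cos ((2 * k + 1) * t) =
        (∑ k ∈ Finset.range n, (2 * (n : ℝ) - 2 * k - 1) * cos ((2 * k + 1) * t)) +
        2 * (∑ k ∈ Finset.range n, cos ((2 * k + 1) * t)) + cos ((2 * n + 1) * t) := by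
      rw [Finset.sum_range_succ, Finset.mul_sum, ← Finset.sum_add_distrib]
      congr 1
      · refine Finset.sum_congr rfl fun k _ => ?_
        push_cast; ring
      · push_cast; ring
    have h2 := two_sin_mul_sum_cos n t
    rw [h1, mul_add, mul_add, ih]
    rw [show 2 * (n : ℝ) * t = 2 * (n * t) by ring, sin_two_mul] at h2
    rw [show ((n + 1 : ℕ) : ℝ) * t = n * t + t by push_cast; ring,
      show (2 * (n : ℝ) + 1) * t = 2 * (n * t) + t by ring, sin_add, cos_add, sin_two_mul,
      cos_two_mul]
    have h3 : sin (n * t) ^ 2 = 1 - cos (n * t) ^ 2 := by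
      have := sin_sq_add_cos_sq (n * t); linarith
    have h4 : sin t ^ 2 = 1 - cos t ^ 2 := by
      have := sin_sq_add_cos_sq t; linarith
    linear_combination sin t * h2 + (cos t * sin t ^ 2) * h3 -
      (cos t * sin (n * t) ^ 2 + 2 * sin (n * t) * sin t * cos (n * t)) * h4

theorem sin_sq_mul_cosPoly_optGains {N : ℕ} (hN : 1 ≤ N) (t : ℝ) :
    (N : ℝ) ^ 2 * sin t ^ 2 * cosPoly N (coeffs N (optGains N)) t = cos t * sin (N * t) ^ 2 := by
  have : (N : ℝ) ≠ 0 := by positivity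
  rw [← sin_sq_mul_sum_cos, cosPoly, ← Fin.sum_univ_eq_sum_range
    (fun k => (2 * (N : ℝ) - 2 * k - 1) * cos ((2 * k + 1) * t)), mul_comm ((N : ℝ) ^ 2), mul_assoc,
    Finset.mul_sum]
  congr 1
  refine Finset.sum_congr rfl fun i _ => ?_
  rw [coeffs_optGains hN, optCoeff]
  push_cast
  field_simp
  ring

theorem cosPoly_optGains_nonneg {N : ℕ} (hN : 1 ≤ N) {t : ℝ} (ht : 0 ≤ cos t) :
    0 ≤ cosPoly N (coeffs N (optGains N)) t := by
  have hN0 : (0 : ℝ) < N := by positivity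
  rcases eq_or_ne (sin t) 0 with h | h
  · have hc : cos t = 1 := by
      have := sin_sq_add_cos_sq t
      rw [h] at this
      nlinarith
    obtain ⟨n, hn⟩ := (cos_eq_one_iff t).1 hc
    have : ∀ i : Fin N, cos ((2 * (i : ℝ) + 1) * t) = 1 := by
      intro i
      rw [cos_eq_one_iff]
      exact ⟨(2 * (i : ℤ) + 1) * n, by rw [← hn]; push_cast; ring⟩
    simp only [cosPoly, this, mul_one, sum_coeffs_eq_one N hN]
    exact zero_le_one
  · have hpos : 0 < (N : ℝ) ^ 2 * sin t ^ 2 := by positivity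
    have h2 := sin_sq_mul_cosPoly_optGains hN t
    have h3 : 0 ≤ cos t * sin (N * t) ^ 2 := by positivity
    rw [← h2] at h3
    exact nonneg_of_mul_nonneg_right h3 hpos

theorem sin_odd_mul_pi_div_two (i : ℕ) : sin ((2 * (i : ℝ) + 1) * (π / 2)) = (-1) ^ i := by
  rw [show (2 * (i : ℝ) + 1) * (π / 2) = i * π + π / 2 by ring, sin_add_pi_div_two,
    cos_nat_mul_pi]

theorem cos_odd_mul_pi_div_two (i : ℕ) : cos ((2 * (i : ℝ) + 1) * (π / 2)) = 0 := by
  rw [show (2 * (i : ℝ) + 1) * (π / 2) = i * π + π / 2 by ring, cos_add_pi_div_two,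
    sin_nat_mul_pi, neg_zero]

theorem sum_alternating (N : ℕ) :
    ∑ k ∈ Finset.range N, (2 * (N : ℝ) - 2 * k - 1) * (-1) ^ k = N := by
  have h : ∀ N : ℕ, 2 * ∑ k ∈ Finset.range N, (-1 : ℝ) ^ k + (-1) ^ N = 1 := by
    intro N
    induction N with
    | zero => simp
    | succ n ih => rw [Finset.sum_range_succ, pow_succ]; linarith
  induction N with
  | zero => simp
  | succ n ih =>
    have h1 : ∑ k ∈ Finset.range (n + 1), (2 * ((n + 1 : ℕ) : ℝ) - 2 * k - 1) * (-1) ^ k =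
        (∑ k ∈ Finset.range n, (2 * (n : ℝ) - 2 * k - 1) * (-1) ^ k) +
        2 * (∑ k ∈ Finset.range n, (-1 : ℝ) ^ k) + (-1) ^ n := by
      rw [Finset.sum_range_succ, Finset.mul_sum, ← Finset.sum_add_distrib]
      congr 1
      · refine Finset.sum_congr rfl fun k _ => ?_
        push_cast; ring
      · push_cast; ring
    rw [h1, ih, add_assoc, h n]
    push_cast
    rfl

theorem sinPoly_optGains_pi_div_two {N : ℕ} (hN : 1 ≤ N) :
    sinPoly N (coeffs N (optGains N)) (π / 2) = 1 / N := by
  have hN0 : (N : ℝ) ≠ 0 := by positivity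
  simp only [sinPoly, sin_odd_mul_pi_div_two, coeffs_optGains hN]
  rw [Fin.sum_univ_eq_sum_range (fun i => optCoeff N (i + 1) * (-1) ^ i)]
  have : ∀ i : ℕ, optCoeff N (i + 1) * (-1) ^ i =
      (2 * (N : ℝ) - 2 * i - 1) * (-1) ^ i / (N : ℝ) ^ 2 := by
    intro i; rw [optCoeff]; push_cast; ring
  simp only [this]
  rw [← Finset.sum_div, sum_alternating]
  field_simp

end Trigonometry

section PartialFractions

/-- Multiplication of a positive combination of simple fractions by `(X - z) / (X - b)`, with
`b < z` smaller than all poles, gives a positive combination again. -/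
theorem exists_simple_fractions_mul {A : Finset ℝ} {γ : ℝ → ℝ} (hγ : ∀ y ∈ A, 0 ≤ γ y) {b z : ℝ}
    (hbz : b < z) (hz : ∀ y ∈ A, z < y) :
    ∃ γ' : ℝ → ℝ, (∀ y ∈ insert b A, 0 ≤ γ' y) ∧ ∀ x ∉ insert b A,
      ∑ y ∈ insert b A, γ' y / (x - y) = (∑ y ∈ A, γ y / (x - y)) * ((x - z) / (x - b)) := by
  have hbA : b ∉ A := fun h => absurd (hz b h) (not_lt.2 hbz.le)
  refine ⟨fun y => if y = b then ∑ u ∈ A, γ u * ((u - b)⁻¹ * (z - b)) else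
    γ y * ((y - z) / (y - b)), ?_, ?_⟩
  · intro y hy
    dsimp only
    split_ifs with h
    · refine Finset.sum_nonneg fun u hu => ?_
      have h1 := hz u hu
      exact mul_nonneg (hγ u hu) (mul_nonneg (inv_nonneg.2 (by linarith)) (by linarith))
    · have hyA := (Finset.mem_insert.1 hy).resolve_left h
      have h1 := hz y hyA
      exact mul_nonneg (hγ y hyA) (div_nonneg (by linarith) (by linarith))
  · intro x hx
    have hxb : x - b ≠ 0 := sub_ne_zero.2 fun h => hx (by simp [h])
    beta_reduce
    rw [Finset.sum_insert hbA, if_pos rfl, Finset.sum_div, ← Finset.sum_add_distrib,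
      Finset.sum_mul]
    refine Finset.sum_congr rfl fun y hy => ?_
    have hyb : y ≠ b := fun h => hbA (h ▸ hy)
    have hxy : x - y ≠ 0 := sub_ne_zero.2 fun h => hx (by simp [h, hy])
    have hyb' : y - b ≠ 0 := sub_ne_zero.2 hyb
    rw [if_neg hyb]
    field_simp
    ring

/-- A positive combination of simple fractions with poles in `A` which, to the right of `min A`,
has the sign of `∏ y ∈ A, (x - y)`. -/
theorem exists_simple_fractions (A : Finset ℝ) (hA : A.Nonempty) :
    ∃ γ : ℝ → ℝ, (∀ y ∈ A, 0 ≤ γ y) ∧ ∀ x ∉ A, (∃ y ∈ A, y < x) →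
      0 < (∑ y ∈ A, γ y / (x - y)) * ∏ y ∈ A, (x - y) := by
  suffices H : A.Nonempty → (∃ γ : ℝ → ℝ, (∀ y ∈ A, 0 ≤ γ y) ∧ ∀ x ∉ A,
      0 < (∑ y ∈ A, γ y / (x - y)) * ∏ y ∈ A, (x - y)) ∨
      (∃ B z, A = insert z B ∧ (∀ y ∈ B, z < y) ∧ ∃ γ : ℝ → ℝ, (∀ y ∈ B, 0 ≤ γ y) ∧ ∀ x ∉ B,
      0 < (∑ y ∈ B, γ y / (x - y)) * ∏ y ∈ B, (x - y)) by
    rcases H hA with ⟨γ, h0, h⟩ | ⟨B, z, rfl, hz, γ, h0, h⟩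
    · exact ⟨γ, h0, fun x hx _ => h x hx⟩
    · have hzB : z ∉ B := fun hh => lt_irrefl _ (hz z hh)
      refine ⟨fun y => if y = z then 0 else γ y, fun y hy => ?_, fun x hx hlt => ?_⟩
      · dsimp only
        split_ifs with hyz
        · exact le_rfl
        · exact h0 y ((Finset.mem_insert.1 hy).resolve_left hyz)
      · have hzx : z < x := by
          obtain ⟨y, hy, hyx⟩ := hlt
          rcases Finset.mem_insert.1 hy with rfl | hy
          · exact hyx
          · exact (hz y hy).trans hyx
        have h1 := h x fun hh => hx (Finset.mem_insert_of_mem hh)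
        beta_reduce
        rw [Finset.sum_insert hzB, Finset.prod_insert hzB, if_pos rfl, zero_div, zero_add]
        have h2 : ∑ y ∈ B, (if y = z then 0 else γ y) / (x - y) = ∑ y ∈ B, γ y / (x - y) := by
          refine Finset.sum_congr rfl fun y hy => ?_
          rw [if_neg fun hh : y = z => hzB (hh ▸ hy)]
        rw [h2, mul_left_comm]
        exact mul_pos (sub_pos.2 hzx) h1
  clear hA
  induction A using Finset.induction_on_min with
  | empty => exact fun h => absurd h Finset.not_nonempty_empty
  | insert b A hb ih =>
    intro _
    have hbA : b ∉ A := fun hh => lt_irrefl _ (hb b hh)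
    rcases A.eq_empty_or_nonempty with rfl | hA
    · refine Or.inl ⟨fun _ => 1, fun _ _ => zero_le_one, fun x hx => ?_⟩
      have hxb : x - b ≠ 0 := sub_ne_zero.2 fun h => hx (by simp [h])
      simp [hxb]
    rcases ih hA with ⟨γ, h0, h⟩ | ⟨B, z, rfl, hz, γ, h0, h⟩
    · exact Or.inr ⟨A, b, rfl, hb, γ, h0, h⟩
    · refine Or.inl ?_
      have hzB : z ∉ B := fun hh => lt_irrefl _ (hz z hh)
      obtain ⟨γ', h0', h'⟩ := exists_simple_fractions_mul h0 (hb z (by simp)) hz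
      have hzb : z ≠ b := fun hh => hbA (by simp [hh])
      have hz' : z ∉ insert b B := by simp [hzb, hzB]
      refine ⟨fun y => if y = z then 0 else γ' y, fun y hy => ?_, fun x hx => ?_⟩
      · dsimp only
        split_ifs with hyz
        · exact le_rfl
        · refine h0' y ?_
          simp only [Finset.mem_insert] at hy ⊢
          tauto
      · rw [Finset.insert_comm] at hx ⊢
        have hxz : x - z ≠ 0 := sub_ne_zero.2 fun hh => hx (by simp [hh])
        have hxb : x - b ≠ 0 := sub_ne_zero.2 fun hh => hx (by simp [hh])
        have h1 := h x fun hh => hx (by simp [hh])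
        have h2 : ∑ y ∈ insert b B, (if y = z then 0 else γ' y) / (x - y) =
            ∑ y ∈ insert b B, γ' y / (x - y) := by
          refine Finset.sum_congr rfl fun y hy => ?_
          rw [if_neg fun hh : y = z => hz' (hh ▸ hy)]
        have hbB : b ∉ B := fun hh => hbA (by simp [hh])
        beta_reduce
        rw [Finset.sum_insert hz', if_pos rfl, zero_div, zero_add, h2,
          h' x fun hh => hx (Finset.mem_insert_of_mem hh), Finset.prod_insert hz',
          Finset.prod_insert hbB]
        have : (∑ y ∈ B, γ y / (x - y)) * ((x - z) / (x - b)) *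
            ((x - z) * ((x - b) * ∏ y ∈ B, (x - y))) =
            (x - z) ^ 2 * ((∑ y ∈ B, γ y / (x - y)) * ∏ y ∈ B, (x - y)) := by
          field_simp
        rw [this]
        positivity

end PartialFractions

section Polynomials

open Polynomial

/-- A real polynomial whose roots in an open interval all have even multiplicity does not change
sign there. -/
theorem eval_mul_eval_nonneg_of_even_rootMultiplicity {u v : ℝ} (p : ℝ[X])
    (hp : ∀ y ∈ Set.Ioo u v, Even (p.rootMultiplicity y)) :
    ∀ x ∈ Set.Ioo u v, ∀ x' ∈ Set.Ioo u v, 0 ≤ p.eval x * p.eval x' := by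
  induction hn : p.natDegree using Nat.strong_induction_on generalizing p with
  | _ n ih =>
    intro x hx x' hx'
    rcases eq_or_ne p 0 with rfl | hp0
    · simp
    by_cases hroot : ∃ y ∈ Set.Ioo u v, p.IsRoot y
    · obtain ⟨y, hy, hyr⟩ := hroot
      have hpos : 0 < p.rootMultiplicity y := (rootMultiplicity_pos hp0).2 hyr
      have htwo : 2 ≤ p.rootMultiplicity y := by
        obtain ⟨k, hk⟩ := hp y hy
        omega
      obtain ⟨q, hq⟩ := (le_rootMultiplicity_iff hp0).1 htwo
      have hq0 : q ≠ 0 := by rintro rfl; simp at hq; exact hp0 hq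
      have hdeg : q.natDegree < n := by
        rw [← hn, hq, natDegree_mul (pow_ne_zero _ (X_sub_C_ne_zero y)) hq0, natDegree_pow,
          natDegree_X_sub_C]
        omega
      have hqe : ∀ w ∈ Set.Ioo u v, Even (q.rootMultiplicity w) := by
        intro w hw
        have h1 := hp w hw
        rw [hq, rootMultiplicity_mul (hq ▸ hp0)] at h1
        have h2 : Even (((X - C y) ^ 2 : ℝ[X]).rootMultiplicity w) := by
          rw [pow_two, rootMultiplicity_mul
            (mul_ne_zero (X_sub_C_ne_zero y) (X_sub_C_ne_zero y))]
          exact ⟨_, rfl⟩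
        exact (Nat.even_add.1 h1).1 h2
      have := ih _ hdeg q hqe rfl x hx x' hx'
      rw [hq]
      simp only [eval_mul, eval_pow, eval_sub, eval_X, eval_C]
      have h3 : (x - y) ^ 2 * q.eval x * ((x' - y) ^ 2 * q.eval x') =
          (x - y) ^ 2 * (x' - y) ^ 2 * (q.eval x * q.eval x') := by ring
      rw [h3]
      positivity
    · by_contra! hneg
      have hsub : Set.uIcc x x' ⊆ Set.Ioo u v := by
        have : Set.OrdConnected (Set.Ioo u v) := inferInstance
        exact this.uIcc_subset hx hx'
      have h0 : (0 : ℝ) ∈ Set.uIcc (p.eval x) (p.eval x') := by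
        rw [Set.mem_uIcc]
        rcases mul_neg_iff.1 hneg with h | h
        · exact Or.inr ⟨h.2.le, h.1.le⟩
        · exact Or.inl ⟨h.1.le, h.2.le⟩
      obtain ⟨y, hy, hy0⟩ := intermediate_value_uIcc p.continuous.continuousOn h0
      exact hroot ⟨y, hsub hy, hy0⟩

/-- A real polynomial changes sign at a root of odd multiplicity. -/
theorem exists_sign_change_of_odd_rootMultiplicity (p : ℝ[X]) (y : ℝ)
    (hodd : Odd (p.rootMultiplicity y)) :
    ∃ η > 0, ∀ x ∈ Set.Ioo (y - η) y, ∀ x' ∈ Set.Ioo y (y + η), p.eval x * p.eval x' < 0 := by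
  have hp0 : p ≠ 0 := by rintro rfl; simp at hodd
  obtain ⟨q, hq, hqy⟩ := exists_eq_pow_rootMultiplicity_mul_and_not_dvd p hp0 y
  rw [dvd_iff_isRoot, IsRoot.def] at hqy
  set k := p.rootMultiplicity y with hk
  have hcont : Filter.Tendsto (fun x => q.eval x * q.eval y) (nhds y)
      (nhds (q.eval y * q.eval y)) := (q.continuous.mul continuous_const).tendsto y
  have hpos : 0 < q.eval y * q.eval y := mul_self_pos.2 hqy
  obtain ⟨η, hη, hball⟩ := Metric.eventually_nhds_iff.1 (hcont.eventually (lt_mem_nhds hpos))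
  refine ⟨η, hη, fun x hx x' hx' => ?_⟩
  have h1 : 0 < q.eval x * q.eval y := hball (by
    rw [Real.dist_eq, abs_lt]; constructor <;> linarith [hx.1, hx.2])
  have h2 : 0 < q.eval x' * q.eval y := hball (by
    rw [Real.dist_eq, abs_lt]; constructor <;> linarith [hx'.1, hx'.2])
  have h3 : 0 < q.eval x * q.eval x' := by
    have : 0 < (q.eval x * q.eval x') * (q.eval y * q.eval y) := by nlinarith [mul_pos h1 h2]
    exact pos_of_mul_pos_left this hpos.le
  have h4 : (x - y) ^ k < 0 := hodd.pow_neg (by linarith [hx.2])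
  have h5 : 0 < (x' - y) ^ k := pow_pos (by linarith [hx'.1]) k
  rw [hq]
  simp only [eval_mul, eval_pow, eval_sub, eval_X, eval_C]
  have h6 : (x - y) ^ k * q.eval x * ((x' - y) ^ k * q.eval x') =
      ((x - y) ^ k * (x' - y) ^ k) * (q.eval x * q.eval x') := by ring
  rw [h6]
  exact mul_neg_of_neg_of_pos (mul_neg_of_neg_of_pos h4 h5) h3

/-- The roots of odd multiplicity in an open interval. -/
noncomputable def oddRoots (p : ℝ[X]) (u v : ℝ) : Finset ℝ :=
  {y ∈ p.roots.toFinset | y ∈ Set.Ioo u v ∧ Odd (p.rootMultiplicity y)}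

theorem mem_oddRoots {p : ℝ[X]} {u v y : ℝ} :
    y ∈ oddRoots p u v ↔ y ∈ Set.Ioo u v ∧ Odd (p.rootMultiplicity y) := by
  rw [oddRoots, Finset.mem_filter, and_iff_right_iff_imp]
  rintro ⟨-, h⟩
  rw [Multiset.mem_toFinset, ← Multiset.count_pos, count_roots]
  exact h.pos

/-- The sign of a polynomial on an interval at the right end of which it is positive. -/
theorem eval_mul_prod_oddRoots_nonneg {p : ℝ[X]} {u v : ℝ} (hv : 0 < p.eval v) :
    ∀ x ∈ Set.Ioo u v, 0 ≤ p.eval x * ∏ y ∈ oddRoots p u v, (x - y) := by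
  have hp0 : p ≠ 0 := by rintro rfl; simp at hv
  set A := oddRoots p u v with hA
  set q : ℝ[X] := ∏ y ∈ A, (X - C y) with hq
  have hq0 : q ≠ 0 := Finset.prod_ne_zero_iff.2 fun y _ => X_sub_C_ne_zero y
  have hqe : ∀ x, q.eval x = ∏ y ∈ A, (x - y) := by
    intro x; simp [hq, eval_prod]
  have hqm : ∀ w, q.rootMultiplicity w = if w ∈ A then 1 else 0 := by
    intro w
    rw [← count_roots, hq, roots_prod_X_sub_C, Multiset.count_eq_of_nodup A.nodup]
    simp
  have heven : ∀ w ∈ Set.Ioo u v, Even ((p * q).rootMultiplicity w) := by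
    intro w hw
    rw [rootMultiplicity_mul (mul_ne_zero hp0 hq0), hqm]
    split_ifs with h
    · exact (mem_oddRoots.1 h).2.add_one
    · rw [add_zero, ← Nat.not_odd_iff_even]
      exact fun ho => h (mem_oddRoots.2 ⟨hw, ho⟩)
  intro x hx
  have hvq : 0 < (p * q).eval v := by
    rw [eval_mul, hqe]
    exact mul_pos hv (Finset.prod_pos fun y hy => sub_pos.2 (mem_oddRoots.1 hy).1.2)
  by_contra! hneg
  rw [← hqe, ← eval_mul] at hneg
  have hev : ∀ᶠ w in nhdsWithin v (Set.Iio v), 0 < (p * q).eval w :=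
    (((p * q).continuous.tendsto v).mono_left nhdsWithin_le_nhds).eventually (lt_mem_nhds hvq)
  obtain ⟨w, hw1, hw2⟩ := (hev.and (Ioo_mem_nhdsLT (hx.1.trans hx.2))).exists
  exact absurd (eval_mul_eval_nonneg_of_even_rootMultiplicity (p * q) heven x hx w hw2)
    (not_le.2 (mul_neg_of_neg_of_pos hneg hw1))

/-- The polynomial `p` of degree `i` with `cos s * p (cos² s) = cos ((2i+1)s)`. -/
noncomputable def oddCosPoly : ℕ → ℝ[X]
  | 0 => 1
  | 1 => C 4 * X - C 3
  | n + 2 => (C 4 * X - C 2) * oddCosPoly (n + 1) - oddCosPoly n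

theorem cos_mul_eval_oddCosPoly (i : ℕ) (s : ℝ) :
    Real.cos s * (oddCosPoly i).eval (Real.cos s ^ 2) = Real.cos ((2 * i + 1) * s) := by
  induction i using Nat.strong_induction_on with
  | _ i ih =>
    match i with
    | 0 => simp [oddCosPoly]
    | 1 =>
      simp only [oddCosPoly, eval_sub, eval_mul, eval_C, eval_X]
      rw [show (2 * ((1 : ℕ) : ℝ) + 1) * s = 3 * s by push_cast; ring, Real.cos_three_mul]
      ring
    | n + 2 =>
      have h1 := ih (n + 1) (by omega)
      have h0 := ih n (by omega)
      simp only [oddCosPoly, eval_sub, eval_mul, eval_C, eval_X]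
      rw [show (2 * ((n + 2 : ℕ) : ℝ) + 1) * s = (2 * ((n + 1 : ℕ) : ℝ) + 1) * s + 2 * s by
        push_cast; ring, Real.cos_add]
      rw [show (2 * (n : ℝ) + 1) * s = (2 * ((n + 1 : ℕ) : ℝ) + 1) * s - 2 * s by
        push_cast; ring, Real.cos_sub] at h0
      rw [Real.cos_two_mul] at h0 ⊢
      linear_combination (4 * Real.cos s ^ 2 - 2) * h1 - h0

theorem degree_oddCosPoly (i : ℕ) : (oddCosPoly i).degree = i := by
  have hl : ∀ c : ℝ, (C 4 * X - C c : ℝ[X]).degree = 1 := by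
    intro c
    rw [sub_eq_add_neg, ← C_neg]
    exact degree_linear (by norm_num)
  induction i using Nat.strong_induction_on with
  | _ i ih =>
    match i with
    | 0 => simp [oddCosPoly]
    | 1 => simpa [oddCosPoly] using hl 3
    | n + 2 =>
      have h1 := ih (n + 1) (by omega)
      have h0 := ih n (by omega)
      have h2 : ((C 4 * X - C 2) * oddCosPoly (n + 1)).degree = ((n + 2 : ℕ) : WithBot ℕ) := by
        rw [degree_mul, hl, h1, add_comm]
        rfl
      rw [oddCosPoly, degree_sub_eq_left_of_degree_lt, h2]
      rw [h2, h0]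
      exact_mod_cast (by omega : n < n + 2)

/-- The polynomial `p` with `cos s * p (cos² s) = C(s)`. -/
noncomputable def reducedPoly (N : ℕ) (a : Coeffs N) : ℝ[X] := ∑ i : Fin N, C (a i) * oddCosPoly i

theorem cos_mul_eval_reducedPoly (N : ℕ) (a : Coeffs N) (s : ℝ) :
    Real.cos s * (reducedPoly N a).eval (Real.cos s ^ 2) = cosPoly N a s := by
  rw [reducedPoly, eval_finsetSum, Finset.mul_sum, cosPoly]
  refine Finset.sum_congr rfl fun i _ => ?_
  rw [eval_mul, eval_C, mul_left_comm, cos_mul_eval_oddCosPoly]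

theorem degree_reducedPoly_lt {N : ℕ} (a : Coeffs N) :
    (reducedPoly N a).degree < (N : WithBot ℕ) := by
  refine (degree_sum_le _ _).trans_lt ((Finset.sup_lt_iff (WithBot.bot_lt_coe N)).2 fun i _ => ?_)
  rw [← smul_eq_C_mul]
  refine (degree_smul_le _ _).trans_lt ?_
  rw [degree_oddCosPoly]
  exact WithBot.coe_lt_coe.2 i.2

theorem reducedPoly_injective (N : ℕ) : Function.Injective (reducedPoly N) := by
  have hS := (⟨oddCosPoly, degree_oddCosPoly⟩ : Polynomial.Sequence ℝ).linearIndependent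
  have hF : LinearIndependent ℝ (fun i : Fin N => oddCosPoly i) :=
    hS.comp (fun i : Fin N => (i : ℕ)) Fin.val_injective
  intro a b hab
  rw [Fintype.linearIndependent_iff] at hF
  have := hF (fun i => a i - b i) (by
    simp only [sub_smul, Finset.sum_sub_distrib, smul_eq_C_mul]
    exact sub_eq_zero.2 hab)
  funext i
  exact sub_eq_zero.1 (this i)

end Polynomials

section ExtremalProblem

open Real

theorem abs_sinPoly_le_rho {N : ℕ} (a : Coeffs N) {t : ℝ} (ht : t ∈ signChanges N a ∪ {π / 2}) :
    |sinPoly N a t| ≤ rho N a := by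
  refine le_csSup ⟨∑ i, |a i|, ?_⟩ ⟨t, ht, rfl⟩
  rintro _ ⟨u, -, rfl⟩
  refine (Finset.abs_sum_le_sum_abs _ _).trans (Finset.sum_le_sum fun i _ => ?_)
  rw [abs_mul]
  exact mul_le_of_le_one_right (abs_nonneg _) (abs_sin_le_one _)

theorem rho_optGains {N : ℕ} (hN : 1 ≤ N) : rho N (coeffs N (optGains N)) = 1 / N := by
  have hempty : signChanges N (coeffs N (optGains N)) = ∅ := by
    refine Set.eq_empty_of_forall_notMem ?_
    rintro t ⟨⟨ht0, ht1⟩, δ, hδ, h⟩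
    obtain ⟨s, hs1, hs2⟩ := exists_between (max_lt (show t - δ < t by linarith) ht0)
    obtain ⟨s', hs1', hs2'⟩ := exists_between (lt_min (show t < t + δ by linarith) ht1)
    rw [max_lt_iff] at hs1
    rw [lt_min_iff] at hs2'
    refine absurd (h s ⟨hs1.1, hs2⟩ s' ⟨hs1', hs2'.1⟩) (not_lt.2 (mul_nonneg ?_ ?_))
    · exact cosPoly_optGains_nonneg hN (cos_nonneg_of_mem_Icc ⟨by linarith, by linarith⟩)
    · exact cosPoly_optGains_nonneg hN (cos_nonneg_of_mem_Icc ⟨by linarith, by linarith⟩)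
  rw [rho, hempty, Set.empty_union, Set.image_singleton, csSup_singleton,
    sinPoly_optGains_pi_div_two hN, abs_of_nonneg (by positivity)]

/-- The divided difference of `cos s * C(s)`, as a function of `cos² s`. -/
noncomputable def dividedCosPoly {N : ℕ} (a : Coeffs N) (t s : ℝ) : ℝ :=
  (∑ i : Fin N, a i * cosKernel i t s) / sin t

theorem sub_mul_dividedCosPoly {N : ℕ} (a : Coeffs N) {t : ℝ} (ht : sin t ≠ 0) (s : ℝ) :
    (cos s ^ 2 - cos t ^ 2) * dividedCosPoly a t s =
      cos s * cosPoly N a s - cos t * cosPoly N a t := by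
  rw [dividedCosPoly, mul_div_assoc', div_eq_iff ht]
  simp only [cosPoly, Finset.mul_sum, ← Finset.sum_sub_distrib, Finset.sum_mul]
  refine Finset.sum_congr rfl fun i _ => ?_
  linear_combination a i * (kernel_identities i t s).1

theorem continuous_dividedCosPoly {N : ℕ} (a : Coeffs N) (t : ℝ) :
    Continuous (dividedCosPoly a t) := by
  unfold dividedCosPoly cosKernel
  fun_prop

theorem sum_dividedCosPoly_nodes {N : ℕ} (a : Coeffs N) (t : ℝ) :
    ∑ k ∈ Finset.range N, dividedCosPoly a t (π * k / N) = N * (sinPoly N a t / sin t) := by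
  simp only [dividedCosPoly]
  rw [← Finset.sum_div, Finset.sum_comm, mul_div_assoc', sinPoly, Finset.mul_sum]
  congr 1
  refine Finset.sum_congr rfl fun i _ => ?_
  rw [← Finset.mul_sum, sum_cosKernel_nodes i.2]
  ring

theorem countable_setOf_cos_eq (v : ℝ) : {s | cos s = v}.Countable := by
  rcases Set.eq_empty_or_nonempty {s | cos s = v} with h | ⟨u, hu⟩
  · rw [h]
    exact Set.countable_empty
  · refine ((Set.countable_range (fun k : ℤ => 2 * (k : ℝ) * π + u)).union
      (Set.countable_range (fun k : ℤ => 2 * (k : ℝ) * π - u))).mono ?_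
    intro s hs
    have hsu : cos u = cos s := Eq.trans hu (Eq.symm hs)
    obtain ⟨k, hk | hk⟩ := cos_eq_cos_iff.1 hsu
    · exact Or.inl ⟨k, hk.symm⟩
    · exact Or.inr ⟨k, hk.symm⟩

theorem dense_setOf_cos_sq_notMem (B : Finset ℝ) : Dense {s | cos s ^ 2 ∉ B} := by
  have hc : {s | cos s ^ 2 ∈ B}.Countable := by
    have : {s | cos s ^ 2 ∈ B} ⊆ ⋃ y ∈ B, ({s | cos s = √y} ∪ {s | cos s = -√y}) := by
      intro s hs
      refine Set.mem_biUnion (show cos s ^ 2 ∈ B from hs) ?_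
      rcases le_total 0 (cos s) with h | h
      · exact Or.inl (sqrt_sq h).symm
      · right
        change cos s = -√(cos s ^ 2)
        rw [← neg_sq, sqrt_sq (neg_nonneg.2 h), neg_neg]
    refine Set.Countable.mono this (B.countable_toSet.biUnion fun y _ => ?_)
    exact (countable_setOf_cos_eq _).union (countable_setOf_cos_eq _)
  exact hc.dense_compl ℝ

theorem dividedCosPoly_pi_div_two {N : ℕ} (a : Coeffs N) (s : ℝ) :
    dividedCosPoly a (π / 2) s = (reducedPoly N a).eval (cos s ^ 2) := by
  refine congrFun (Continuous.ext_on (dense_setOf_cos_sq_notMem {0})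
    (continuous_dividedCosPoly a _)
    ((reducedPoly N a).continuous.comp (continuous_cos.pow 2)) ?_) s
  intro u hu
  have hu' : cos u ≠ 0 := by
    intro h
    exact hu (by simp [h])
  have h1 := sub_mul_dividedCosPoly a (t := π / 2) (by simp) u
  rw [← cos_mul_eval_reducedPoly, cos_pi_div_two] at h1
  have h2 : cos u ^ 2 ≠ 0 := pow_ne_zero _ hu'
  refine mul_left_cancel₀ h2 ?_
  change cos u ^ 2 * dividedCosPoly a (π / 2) u =
    cos u ^ 2 * (reducedPoly N a).eval (cos u ^ 2)
  linear_combination h1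

theorem eval_reducedPoly_one {N : ℕ} {a : Coeffs N} (ha : ∑ i, a i = 1) :
    (reducedPoly N a).eval 1 = 1 := by
  have := cos_mul_eval_reducedPoly N a 0
  simpa [cosPoly, ha] using this

theorem arccos_sqrt_mem_signChanges {N : ℕ} {a : Coeffs N} {y : ℝ}
    (hy : y ∈ oddRoots (reducedPoly N a) 0 1) : arccos √y ∈ signChanges N a := by
  obtain ⟨⟨hy0, hy1⟩, hodd⟩ := mem_oddRoots.1 hy
  obtain ⟨η, hη, hsign⟩ := exists_sign_change_of_odd_rootMultiplicity _ y hodd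
  have hs0 : 0 < √y := sqrt_pos.2 hy0
  have hs1 : √y < 1 := by rw [sqrt_lt' one_pos]; simpa using hy1
  set t := arccos √y with ht
  have hcos : cos t = √y := cos_arccos (by linarith) hs1.le
  have hcos2 : cos t ^ 2 = y := by rw [hcos, sq_sqrt hy0.le]
  have ht0 : 0 < t := arccos_pos.2 hs1
  have ht1 : t < π / 2 := arccos_lt_pi_div_two.2 hs0
  have hcont : Continuous fun s => cos s ^ 2 := by fun_prop
  obtain ⟨δ, hδ, hball⟩ := Metric.continuous_iff.1 hcont t η hη
  refine ⟨⟨ht0, ht1⟩, min δ (min t (π / 2 - t)), by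
    simp only [gt_iff_lt, lt_min_iff]; exact ⟨hδ, ht0, by linarith⟩, ?_⟩
  rintro s ⟨hs1, hs2⟩ s' ⟨hs1', hs2'⟩
  have hm1 := min_le_left δ (min t (π / 2 - t))
  have hm2 := (min_le_right δ (min t (π / 2 - t))).trans (min_le_left _ _)
  have hm3 := (min_le_right δ (min t (π / 2 - t))).trans (min_le_right _ _)
  have hcs : 0 < cos s := cos_pos_of_mem_Ioo ⟨by linarith, by linarith⟩
  have hcs' : 0 < cos s' := cos_pos_of_mem_Ioo ⟨by linarith, by linarith⟩
  have hlt : cos t < cos s := cos_lt_cos_of_nonneg_of_le_pi_div_two (by linarith) ht1.le hs2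
  have hlt' : cos s' < cos t :=
    cos_lt_cos_of_nonneg_of_le_pi_div_two ht0.le (by linarith) hs1'
  have hd := hball s (by rw [dist_eq, abs_lt]; constructor <;> linarith)
  have hd' := hball s' (by rw [dist_eq, abs_lt]; constructor <;> linarith)
  rw [hcos2, dist_eq, abs_lt] at hd hd'
  have h1 : y < cos s ^ 2 := by rw [← hcos2]; nlinarith
  have h2 : cos s' ^ 2 < y := by rw [← hcos2]; nlinarith
  have h3 := hsign _ ⟨by linarith, h2⟩ _ ⟨h1, by linarith⟩
  rw [← cos_mul_eval_reducedPoly, ← cos_mul_eval_reducedPoly]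
  have h4 : 0 < cos s * cos s' := mul_pos hcs hcs'
  nlinarith [mul_neg_of_pos_of_neg h4 h3]

/-- If `ρ(a) ≤ 1/N`, then `C(s) / cos s` is nonnegative, and it vanishes at the nodes `πk/N`. -/
theorem eval_reducedPoly_of_rho_le {N : ℕ} (hN : 1 ≤ N) {a : Coeffs N} (ha : ∑ i, a i = 1)
    (hρ : rho N a ≤ 1 / N) :
    (∀ s, 0 ≤ (reducedPoly N a).eval (cos s ^ 2)) ∧
      ∀ k : ℕ, 1 ≤ k → k < N → (reducedPoly N a).eval (cos (π * k / N) ^ 2) = 0 := by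
  have hN0 : (0 : ℝ) < N := by positivity
  set c := reducedPoly N a with hc
  have hc1 : c.eval 1 = 1 := eval_reducedPoly_one ha
  set A₀ := oddRoots c 0 1 with hA₀
  set A := insert 0 A₀ with hA
  have h0A : (0 : ℝ) ∉ A₀ := fun h => lt_irrefl _ (mem_oddRoots.1 h).1.1
  have hAI : ∀ y ∈ A, 0 ≤ y ∧ y < 1 := by
    intro y hy
    rcases Finset.mem_insert.1 hy with rfl | hy
    · exact ⟨le_rfl, one_pos⟩
    · exact ⟨(mem_oddRoots.1 hy).1.1.le, (mem_oddRoots.1 hy).1.2⟩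
  set τ : ℝ → ℝ := fun y => arccos √y with hτ
  have hτcos : ∀ y ∈ A, cos (τ y) = √y := fun y hy =>
    cos_arccos (by linarith [sqrt_nonneg y]) (sqrt_le_one.2 (hAI y hy).2.le)
  have hτsin : ∀ y ∈ A, sin (τ y) = √(1 - y) := fun y hy => by
    rw [hτ, sin_arccos, sq_sqrt (hAI y hy).1]
  have hsqrt : ∀ y ∈ A, 0 < √(1 - y) := fun y hy => sqrt_pos.2 (by linarith [(hAI y hy).2])
  have hτ0 : τ 0 = π / 2 := by simp [hτ]
  have hτρ : ∀ y ∈ A, sinPoly N a (τ y) ≤ 1 / N := by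
    intro y hy
    refine (le_abs_self _).trans ((abs_sinPoly_le_rho a ?_).trans hρ)
    rcases Finset.mem_insert.1 hy with rfl | hy
    · exact Or.inr hτ0
    · exact Or.inl (arccos_sqrt_mem_signChanges hy)
  have hzero : ∀ y ∈ A, cos (τ y) * cosPoly N a (τ y) = 0 := by
    intro y hy
    rw [← cos_mul_eval_reducedPoly, hτcos y hy, sq_sqrt (hAI y hy).1]
    rcases Finset.mem_insert.1 hy with rfl | hy
    · simp
    · have hroot : c.eval y = 0 := by
        have h := (mem_oddRoots.1 hy).2.pos
        exact (Polynomial.rootMultiplicity_pos' .. |>.1 h).2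
      rw [hroot]
      ring
  have hq : ∀ y ∈ A, ∀ s, (cos s ^ 2 - y) * dividedCosPoly a (τ y) s =
      cos s ^ 2 * c.eval (cos s ^ 2) := by
    intro y hy s
    have h := sub_mul_dividedCosPoly a (t := τ y) (by rw [hτsin y hy]; exact (hsqrt y hy).ne') s
    rw [hzero y hy, hτcos y hy, sq_sqrt (hAI y hy).1, sub_zero, ← cos_mul_eval_reducedPoly] at h
    rw [h]
    ring
  obtain ⟨γ, hγ, hf⟩ := exists_simple_fractions A ⟨0, by simp [hA]⟩
  set f : ℝ → ℝ := fun x => ∑ y ∈ A, γ y / (x - y) with hfdef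
  set P : ℝ → ℝ := fun s => ∑ y ∈ A, γ y * dividedCosPoly a (τ y) s with hP
  have hPf : ∀ s, cos s ^ 2 ∉ A → P s = cos s ^ 2 * (c.eval (cos s ^ 2) * f (cos s ^ 2)) := by
    intro s hs
    rw [hP, hfdef]
    dsimp only
    rw [← mul_assoc, Finset.mul_sum]
    refine Finset.sum_congr rfl fun y hy => ?_
    have hne : cos s ^ 2 - y ≠ 0 := sub_ne_zero.2 fun h => hs (h ▸ hy)
    rw [← hq y hy s]
    field_simp
  have hcf : ∀ x ∈ Set.Ioo (0 : ℝ) 1, x ∉ A → 0 ≤ c.eval x * f x := by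
    intro x hx hxA
    have h1 := hf x hxA ⟨0, by simp [hA], hx.1⟩
    have h2 := eval_mul_prod_oddRoots_nonneg (p := c) (u := 0) (v := 1) (by rw [hc1]; exact one_pos)
      x hx
    rw [hA, Finset.prod_insert h0A, sub_zero, ← hA] at h1
    rw [← hA₀] at h2
    have hprod : ∏ y ∈ A₀, (x - y) ≠ 0 := Finset.prod_ne_zero_iff.2 fun y hy =>
      sub_ne_zero.2 fun h => hxA (by rw [h]; exact Finset.mem_insert_of_mem hy)
    have h3 : 0 < x * (∏ y ∈ A₀, (x - y)) ^ 2 := mul_pos hx.1 (by positivity)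
    have h4 := mul_nonneg h2 h1.le
    refine nonneg_of_mul_nonneg_left (b := x * (∏ y ∈ A₀, (x - y)) ^ 2) ?_ h3
    calc 0 ≤ _ := h4
      _ = _ := by rw [hfdef]; ring
  have hPcont : Continuous P := by
    rw [hP]
    exact continuous_finsetSum _ fun y _ => continuous_const.mul (continuous_dividedCosPoly a _)
  have hPnonneg : ∀ s, 0 ≤ P s := by
    have hcl : IsClosed {s | 0 ≤ P s} := isClosed_le continuous_const hPcont
    have hsub : {s | cos s ^ 2 ∉ insert 1 A} ⊆ {s | 0 ≤ P s} := by
      intro s hs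
      have hs1 : cos s ^ 2 ≠ 1 := fun h => hs (by simp [h])
      have hs2 : cos s ^ 2 ∉ A := fun h => hs (Finset.mem_insert_of_mem h)
      have hs0 : cos s ^ 2 ≠ 0 := fun h => hs2 (by simp [h, hA])
      change 0 ≤ P s
      rw [hPf s hs2]
      refine mul_nonneg (sq_nonneg _) (hcf _ ⟨(sq_nonneg _).lt_of_ne' hs0, ?_⟩ hs2)
      exact (cos_sq_le_one s).lt_of_ne hs1
    intro s
    have h := hcl.closure_subset_iff.2 hsub
    rw [(dense_setOf_cos_sq_notMem (insert 1 A)).closure_eq] at h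
    exact h (Set.mem_univ s)
  have h1A : (1 : ℝ) ∉ A := fun h => lt_irrefl _ (hAI 1 h).2
  have hf1 : 0 < f 1 := by
    have h := hf 1 h1A ⟨0, by simp [hA], one_pos⟩
    exact pos_of_mul_pos_left h
      (Finset.prod_pos fun y hy => sub_pos.2 (hAI y hy).2).le
  have hP0 : P 0 = f 1 := by
    have h := hPf 0 (by simpa using h1A)
    simpa [hc1] using h
  have hsum : ∑ k ∈ Finset.range N, P (π * k / N) =
      ∑ y ∈ A, γ y * (N * (sinPoly N a (τ y) / √(1 - y))) := by
    rw [hP]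
    dsimp only
    rw [Finset.sum_comm]
    refine Finset.sum_congr rfl fun y hy => ?_
    rw [← Finset.mul_sum, sum_dividedCosPoly_nodes, hτsin y hy]
  have hterm : ∀ y ∈ A, γ y * (N * (sinPoly N a (τ y) / √(1 - y))) ≤ γ y / √(1 - y) := by
    intro y hy
    have h1 : (N : ℝ) * sinPoly N a (τ y) ≤ 1 := by
      have := mul_le_mul_of_nonneg_left (hτρ y hy) hN0.le
      rwa [mul_one_div_cancel hN0.ne'] at this
    rw [mul_div_assoc', div_eq_mul_inv, div_eq_mul_inv]
    refine mul_le_mul_of_nonneg_left ?_ (hγ y hy)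
    exact mul_le_of_le_one_left (inv_nonneg.2 (sqrt_nonneg _)) h1
  have hterm' : ∀ y ∈ A, γ y / √(1 - y) ≤ γ y / (1 - y) := by
    intro y hy
    have h1 : 0 < 1 - y := by linarith [(hAI y hy).2]
    refine div_le_div_of_nonneg_left (hγ y hy) h1 ?_
    rw [le_sqrt' h1]
    nlinarith [(hAI y hy).1]
  have hle1 : P 0 ≤ ∑ k ∈ Finset.range N, P (π * k / N) := by
    have := Finset.single_le_sum (f := fun k : ℕ => P (π * k / N))
      (fun k _ => hPnonneg _) (Finset.mem_range.2 (show 0 < N by omega))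
    simpa using this
  have hle2 : ∑ k ∈ Finset.range N, P (π * k / N) ≤ ∑ y ∈ A, γ y / √(1 - y) :=
    hsum.trans_le (Finset.sum_le_sum hterm)
  have hle3 : ∑ y ∈ A, γ y / √(1 - y) ≤ f 1 := Finset.sum_le_sum hterm'
  have heq : ∀ y ∈ A, γ y / √(1 - y) = γ y / (1 - y) :=
    (Finset.sum_eq_sum_iff_of_le hterm').1 (le_antisymm hle3 (by linarith))
  have hγ0 : ∀ y ∈ A₀, γ y = 0 := by
    intro y hy
    have hyA : y ∈ A := Finset.mem_insert_of_mem hy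
    have hI := (mem_oddRoots.1 hy).1
    by_contra hne
    have h1 := heq y hyA
    rw [div_eq_div_iff (hsqrt y hyA).ne' (by linarith [hI.2])] at h1
    have h3 := mul_self_sqrt (show 0 ≤ 1 - y by linarith [hI.2])
    rw [← mul_left_cancel₀ hne h1] at h3
    have h2 : (1 - y) * y = 0 := by linarith
    rcases mul_eq_zero.1 h2 with h | h
    · linarith [hI.2]
    · linarith [hI.1]
  have hPc : ∀ s, P s = γ 0 * c.eval (cos s ^ 2) := by
    intro s
    rw [hP]
    dsimp only
    rw [hA, Finset.sum_insert h0A, hτ0, dividedCosPoly_pi_div_two,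
      Finset.sum_eq_zero fun y hy => by rw [hγ0 y hy, zero_mul], add_zero]
  have hγpos : 0 < γ 0 := by
    have := hPc 0
    rw [hP0] at this
    simp only [cos_zero, one_pow, hc1, mul_one] at this
    rw [← this]
    exact hf1
  refine ⟨fun s => ?_, fun k hk hkN => ?_⟩
  · have := hPnonneg s
    rw [hPc] at this
    exact nonneg_of_mul_nonneg_right this hγpos
  · have hpair : P 0 + P (π * k / N) ≤ ∑ k ∈ Finset.range N, P (π * k / N) := by
      have := Finset.sum_le_sum_of_subset_of_nonneg (s := {0, k}) (t := Finset.range N)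
        (f := fun k : ℕ => P (π * k / N)) (by
          intro j hj
          simp only [Finset.mem_insert, Finset.mem_singleton] at hj
          rw [Finset.mem_range]
          omega) (fun _ _ _ => hPnonneg _)
      rw [Finset.sum_pair (by omega)] at this
      simpa using this
    have h0 : P (π * k / N) = 0 := le_antisymm (by linarith) (hPnonneg _)
    rw [hPc] at h0
    exact (mul_eq_zero.1 h0).resolve_left hγpos.ne'

theorem cos_sq_node_eq {N : ℕ} {j k : ℕ} (hj : j < N) (hk : k < N)
    (h : cos (π * j / N) ^ 2 = cos (π * k / N) ^ 2) : j = k ∨ (cos (π * k / N) ≠ 0 ∧ j + k = N) := by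
  have hN : (0 : ℝ) < N := by exact_mod_cast (by omega : 0 < N)
  have hmem : ∀ i : ℕ, i ≤ N → π * i / N ∈ Set.Icc 0 π := by
    intro i hi
    have hi' : (i : ℝ) ≤ N := by exact_mod_cast hi
    have := pi_pos
    refine ⟨by positivity, ?_⟩
    rw [div_le_iff₀ hN]
    nlinarith
  have hinj : ∀ i i' : ℕ, i ≤ N → i' ≤ N → cos (π * i / N) = cos (π * i' / N) → i = i' := by
    intro i i' hi hi' hcos
    have h1 := injOn_cos (hmem i hi) (hmem i' hi') hcos
    have := pi_pos.ne'
    field_simp at h1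
    exact_mod_cast h1
  by_cases hjk : j = k
  · exact Or.inl hjk
  rcases sq_eq_sq_iff_eq_or_eq_neg.1 h with h | h
  · exact absurd (hinj j k hj.le hk.le h) hjk
  · refine Or.inr ⟨fun h0 => hjk (hinj j k hj.le hk.le (by rw [h, h0, neg_zero])), ?_⟩
    rw [← cos_pi_sub] at h
    have h2 := hinj j (N - k) hj.le (by omega) (by
      rw [h, Nat.cast_sub hk.le]
      congr 1
      field_simp)
    omega

/-- A polynomial of degree less than `N` is determined by its value at `1` if it is nonnegative
on `[0, 1]` and vanishes at the points `cos² (πk/N)`. -/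
theorem eq_of_nonneg_of_eval_nodes {N : ℕ} {p q : Polynomial ℝ}
    (hpd : p.degree < (N : WithBot ℕ)) (hqd : q.degree < (N : WithBot ℕ))
    (h1 : p.eval 1 = q.eval 1)
    (hp : ∀ s, 0 ≤ p.eval (cos s ^ 2)) (hq : ∀ s, 0 ≤ q.eval (cos s ^ 2))
    (hp0 : ∀ k : ℕ, 1 ≤ k → k < N → p.eval (cos (π * k / N) ^ 2) = 0)
    (hq0 : ∀ k : ℕ, 1 ≤ k → k < N → q.eval (cos (π * k / N) ^ 2) = 0) : p = q := by
  classical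
  by_contra hne
  set d := p - q with hd
  have hd0 : d ≠ 0 := sub_ne_zero.2 hne
  have hdd : d.natDegree < N := by
    rw [Polynomial.natDegree_lt_iff_degree_lt hd0]
    exact (Polynomial.degree_sub_le p q).trans_lt (max_lt hpd hqd)
  set x : ℕ → ℝ := fun k => cos (π * k / N) ^ 2 with hx
  have hderiv : ∀ r : Polynomial ℝ, (∀ s, 0 ≤ r.eval (cos s ^ 2)) → ∀ y ∈ Set.Ioo (0 : ℝ) 1,
      r.eval y = 0 → r.derivative.eval y = 0 := by
    intro r hr y hy hry
    have hmin : IsLocalMin (fun z => r.eval z) y := by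
      filter_upwards [Ioo_mem_nhds hy.1 hy.2] with z hz
      have h2 := hr (arccos √z)
      rw [cos_arccos (by linarith [sqrt_nonneg z]) (sqrt_le_one.2 hz.2.le), sq_sqrt hz.1.le] at h2
      rw [hry]
      exact h2
    have := hmin.deriv_eq_zero
    rwa [Polynomial.deriv] at this
  have hroot : ∀ k < N, d.IsRoot (x k) := by
    intro k hk
    rw [Polynomial.IsRoot.def, hd, Polynomial.eval_sub, sub_eq_zero]
    rcases Nat.eq_zero_or_pos k with rfl | hpos
    · simpa [hx] using h1
    · rw [hp0 k hpos hk, hq0 k hpos hk]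
  have hmult : ∀ y ∈ (Finset.range N).image x,
      ((Finset.range N).filter fun k => x k = y).card ≤ d.roots.count y := by
    intro y hy
    obtain ⟨k, hk, rfl⟩ := Finset.mem_image.1 hy
    have hk := Finset.mem_range.1 hk
    rw [Polynomial.count_roots]
    have hpos : 0 < d.rootMultiplicity (x k) := (Polynomial.rootMultiplicity_pos hd0).2 (hroot k hk)
    by_cases hcase : k = 0 ∨ cos (π * k / N) = 0
    · refine le_trans ?_ hpos
      rw [Finset.card_le_one_iff_subset_singleton]
      refine ⟨k, fun j hj => ?_⟩
      rw [Finset.mem_filter, Finset.mem_range] at hj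
      rw [Finset.mem_singleton]
      rcases cos_sq_node_eq hj.1 hk hj.2 with h | ⟨h, h'⟩
      · exact h
      · rcases hcase with rfl | h0
        · omega
        · exact absurd h0 h
    · push Not at hcase
      have hk1 : 1 ≤ k := by omega
      have hxI : x k ∈ Set.Ioo (0 : ℝ) 1 := by
        refine ⟨by have := hcase.2; positivity, (cos_sq_le_one _).lt_of_ne fun h => ?_⟩
        have h2 : x k = cos (π * (0 : ℕ) / N) ^ 2 := by simpa [hx] using h
        rcases cos_sq_node_eq hk (by omega) h2 with h3 | ⟨-, h3⟩ <;> omega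
      have htwo : 1 < d.rootMultiplicity (x k) := by
        rw [Polynomial.one_lt_rootMultiplicity_iff_isRoot hd0]
        refine ⟨hroot k hk, ?_⟩
        rw [Polynomial.IsRoot.def, hd, Polynomial.derivative_sub, Polynomial.eval_sub,
          hderiv p hp _ hxI (hp0 k hk1 hk), hderiv q hq _ hxI (hq0 k hk1 hk), sub_zero]
      refine le_trans ?_ htwo
      refine (Finset.card_le_card (t := {k, N - k}) fun j hj => ?_).trans Finset.card_le_two
      rw [Finset.mem_filter, Finset.mem_range] at hj
      rw [Finset.mem_insert, Finset.mem_singleton]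
      rcases cos_sq_node_eq hj.1 hk hj.2 with h | ⟨-, h⟩
      · exact Or.inl h
      · exact Or.inr (by omega)
  have hsub : (Finset.range N).image x ⊆ d.roots.toFinset := by
    intro y hy
    obtain ⟨k, hk, rfl⟩ := Finset.mem_image.1 hy
    rw [Multiset.mem_toFinset, Polynomial.mem_roots hd0]
    exact hroot k (Finset.mem_range.1 hk)
  have hcard : N ≤ d.roots.card :=
    calc N = (Finset.range N).card := (Finset.card_range N).symm
      _ = ∑ y ∈ (Finset.range N).image x, ((Finset.range N).filter fun k => x k = y).card :=
        Finset.card_eq_sum_card_image x _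
      _ ≤ ∑ y ∈ (Finset.range N).image x, d.roots.count y := Finset.sum_le_sum hmult
      _ ≤ ∑ y ∈ d.roots.toFinset, d.roots.count y :=
        Finset.sum_le_sum_of_subset hsub
      _ = d.roots.card := Multiset.toFinset_sum_count_eq _
  have := d.card_roots'
  omega

theorem eq_optGains_of_rho_le {N : ℕ} (hN : 1 ≤ N) {ε : Gains N}
    (hρ : rho N (coeffs N ε) ≤ 1 / N) : ε = optGains N := by
  have h1 := sum_coeffs_eq_one N hN ε
  have h2 := sum_coeffs_eq_one N hN (optGains N)
  obtain ⟨hp, hp0⟩ := eval_reducedPoly_of_rho_le hN h1 hρ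
  obtain ⟨hq, hq0⟩ := eval_reducedPoly_of_rho_le hN h2 (rho_optGains hN).le
  refine coeffs_injective N (reducedPoly_injective N ?_)
  refine eq_of_nonneg_of_eval_nodes (degree_reducedPoly_lt _) (degree_reducedPoly_lt _) ?_
    hp hq hp0 hq0
  rw [eval_reducedPoly_one h1, eval_reducedPoly_one h2]

theorem rho_optGains_lt {N : ℕ} (hN : 1 ≤ N) {ε : Gains N} (hε : ε ≠ optGains N) :
    1 / N < rho N (coeffs N ε) := by
  by_contra! h
  exact hε (eq_optGains_of_rho_le hN h)

end ExtremalProblem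

section CharacteristicFunction

open Complex

/-- `F(w) = ∑ a_j w^(2j-1)`; the characteristic equation reads `μ F(w)² = 1` for `λ = w⁻²`. -/
noncomputable def charFun {N : ℕ} (a : Coeffs N) (w : ℂ) : ℂ :=
  ∑ i : Fin N, (a i : ℂ) * w ^ (2 * (i : ℕ) + 1)

theorem continuous_charFun {N : ℕ} (a : Coeffs N) : Continuous (charFun a) := by
  unfold charFun
  fun_prop

theorem charFun_neg {N : ℕ} (a : Coeffs N) (w : ℂ) : charFun a (-w) = -charFun a w := by
  unfold charFun
  rw [← Finset.sum_neg_distrib]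
  refine Finset.sum_congr rfl fun i _ => ?_
  rw [Odd.neg_pow ⟨(i : ℕ), rfl⟩, mul_neg]

theorem charFun_zero {N : ℕ} (a : Coeffs N) : charFun a 0 = 0 := by
  simp [charFun]

theorem charFun_one {N : ℕ} {a : Coeffs N} (ha : ∑ i, a i = 1) : charFun a 1 = 1 := by
  simp only [charFun, one_pow, mul_one]
  exact_mod_cast ha

theorem charFun_polar {N : ℕ} (a : Coeffs N) (r s : ℝ) :
    charFun a (r * exp (s * I)) =
      ((∑ i : Fin N, a i * (r ^ (2 * (i : ℕ) + 1) * Real.cos ((2 * (i : ℝ) + 1) * s)) : ℝ) : ℂ) +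
      ((∑ i : Fin N, a i * (r ^ (2 * (i : ℕ) + 1) * Real.sin ((2 * (i : ℝ) + 1) * s)) : ℝ) : ℂ) *
        I := by
  unfold charFun
  rw [ofReal_sum, ofReal_sum, Finset.sum_mul, ← Finset.sum_add_distrib]
  refine Finset.sum_congr rfl fun i _ => ?_
  rw [mul_pow, ← exp_nat_mul, show ((2 * (i : ℕ) + 1 : ℕ) : ℂ) * (s * I) =
    (((2 * (i : ℝ) + 1) * s : ℝ) : ℂ) * I by push_cast; ring, exp_mul_I, ← ofReal_cos,
    ← ofReal_sin]
  push_cast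
  ring

theorem charFun_polar_re {N : ℕ} (a : Coeffs N) (r s : ℝ) : (charFun a (r * exp (s * I))).re =
    ∑ i : Fin N, a i * (r ^ (2 * (i : ℕ) + 1) * Real.cos ((2 * (i : ℝ) + 1) * s)) := by
  rw [charFun_polar, add_re, re_ofReal_mul, ofReal_re, I_re, mul_zero, add_zero]

theorem charFun_polar_im {N : ℕ} (a : Coeffs N) (r s : ℝ) : (charFun a (r * exp (s * I))).im =
    ∑ i : Fin N, a i * (r ^ (2 * (i : ℕ) + 1) * Real.sin ((2 * (i : ℝ) + 1) * s)) := by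
  rw [charFun_polar, add_im, im_ofReal_mul, ofReal_im, I_im, mul_one, zero_add]

theorem charFun_exp_re {N : ℕ} (a : Coeffs N) (s : ℝ) :
    (charFun a (exp (s * I))).re = cosPoly N a s := by
  have := charFun_polar_re a 1 s
  simpa [cosPoly] using this

theorem charFun_exp_im {N : ℕ} (a : Coeffs N) (s : ℝ) :
    (charFun a (exp (s * I))).im = sinPoly N a s := by
  have := charFun_polar_im a 1 s
  simpa [sinPoly] using this

theorem charFun_ofReal_mul_I_re {N : ℕ} (a : Coeffs N) (r : ℝ) :
    (charFun a (r * I)).re = 0 := by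
  have h := charFun_polar_re a r (Real.pi / 2)
  rw [show ((Real.pi / 2 : ℝ) : ℂ) * I = Real.pi / 2 * I by push_cast; ring,
    exp_pi_div_two_mul_I] at h
  rw [h]
  exact Finset.sum_eq_zero fun i _ => by rw [cos_odd_mul_pi_div_two, mul_zero, mul_zero]

theorem charFun_I_im {N : ℕ} (a : Coeffs N) : (charFun a I).im = sinPoly N a (Real.pi / 2) := by
  rw [← charFun_exp_im, show ((Real.pi / 2 : ℝ) : ℂ) * I = Real.pi / 2 * I by push_cast; ring,
    exp_pi_div_two_mul_I]

/-- Near a sign change of `C` the image of the open unit disc meets the imaginary axis. -/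
theorem exists_charFun_re_eq_zero {N : ℕ} (a : Coeffs N) {κ t : ℝ}
    (ht : t ∈ signChanges N a ∪ {Real.pi / 2}) (hκ : κ < |sinPoly N a t|) :
    ∃ w : ℂ, ‖w‖ < 1 ∧ (charFun a w).re = 0 ∧ κ < |(charFun a w).im| := by
  have hF := continuous_charFun a
  rcases ht with ⟨-, δ, hδ, hsign⟩ | rfl
  · set G : ℝ × ℝ → ℂ := fun p => charFun a (p.1 * exp (p.2 * I)) with hG
    have hGc : Continuous G := hF.comp (by fun_prop)
    have hre : ∀ s, (G (1, s)).re = cosPoly N a s := fun s => by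
      simp [hG, charFun_exp_re]
    have hopen : IsOpen {p | κ < |(G p).im|} :=
      isOpen_lt continuous_const (continuous_im.comp hGc).abs
    have hmem : ((1, t) : ℝ × ℝ) ∈ {p | κ < |(G p).im|} := by
      simp only [Set.mem_ofPred_eq, hG, ofReal_one, one_mul, charFun_exp_im]
      exact hκ
    obtain ⟨η, hη, hball⟩ := Metric.isOpen_iff.1 hopen _ hmem
    obtain ⟨u, hu1, hu2⟩ := exists_between
      (max_lt (show t - δ < t by linarith) (show t - η < t by linarith))
    obtain ⟨v, hv1, hv2⟩ := exists_between
      (lt_min (show t < t + δ by linarith) (show t < t + η by linarith))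
    rw [max_lt_iff] at hu1
    rw [lt_min_iff] at hv2
    have hneg : (G (1, u)).re * (G (1, v)).re < 0 := by
      rw [hre, hre]
      exact hsign u ⟨hu1.1, hu2⟩ v ⟨hv1, hv2.1⟩
    have hcont : Continuous fun r : ℝ => (G (r, u)).re * (G (r, v)).re :=
      (continuous_re.comp (hGc.comp (by fun_prop))).mul
        (continuous_re.comp (hGc.comp (by fun_prop)))
    have hev : ∀ᶠ r in nhdsWithin (1 : ℝ) (Set.Iio 1), (G (r, u)).re * (G (r, v)).re < 0 :=
      ((hcont.tendsto 1).mono_left nhdsWithin_le_nhds).eventually (gt_mem_nhds hneg)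
    obtain ⟨r, hr, hr1, hr2⟩ :=
      (hev.and (Ioo_mem_nhdsLT (max_lt one_pos (show 1 - η < 1 by linarith)))).exists
    rw [max_lt_iff] at hr1
    have h0 : (0 : ℝ) ∈ Set.uIcc (G (r, u)).re (G (r, v)).re := by
      rw [Set.mem_uIcc]
      rcases mul_neg_iff.1 hr with h | h
      · exact Or.inr ⟨h.2.le, h.1.le⟩
      · exact Or.inl ⟨h.1.le, h.2.le⟩
    obtain ⟨s, hs, hs0⟩ := intermediate_value_uIcc
      (f := fun s => (G (r, s)).re)
      (continuous_re.comp (hGc.comp (by fun_prop))).continuousOn h0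
    rw [Set.uIcc_of_le (hu2.trans hv1).le] at hs
    refine ⟨r * exp (s * I), ?_, hs0, ?_⟩
    · rw [norm_mul, norm_exp_ofReal_mul_I, mul_one, norm_real, Real.norm_eq_abs,
        abs_of_pos hr1.1]
      exact hr2
    · refine hball (a := (r, s)) ?_
      rw [Metric.mem_ball, Prod.dist_eq, max_lt_iff, Real.dist_eq, Real.dist_eq, abs_lt, abs_lt]
      refine ⟨⟨?_, ?_⟩, ?_, ?_⟩ <;> dsimp only <;> linarith [hs.1, hs.2]
  · have hcont : Continuous fun r : ℝ => |(charFun a (r * I)).im| :=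
      (continuous_im.comp (hF.comp (by fun_prop))).abs
    have h1 : κ < |(charFun a ((1 : ℝ) * I)).im| := by
      rw [ofReal_one, one_mul, charFun_I_im]
      exact hκ
    have hev : ∀ᶠ r : ℝ in nhdsWithin 1 (Set.Iio 1), κ < |(charFun a (r * I)).im| :=
      ((hcont.tendsto 1).mono_left nhdsWithin_le_nhds).eventually (lt_mem_nhds h1)
    obtain ⟨r, hr, hr1, hr2⟩ := (hev.and (Ioo_mem_nhdsLT (zero_lt_one' ℝ))).exists
    refine ⟨r * I, ?_, charFun_ofReal_mul_I_re a r, hr⟩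
    rw [norm_mul, norm_I, mul_one, norm_real, Real.norm_eq_abs, abs_of_pos hr1]
    exact hr2

theorem charFun_eq_mul {N : ℕ} (a : Coeffs N) (w : ℂ) :
    charFun a w = w * ∑ i : Fin N, (a i : ℂ) * (w ^ 2) ^ (i : ℕ) := by
  rw [charFun, Finset.mul_sum]
  refine Finset.sum_congr rfl fun i _ => ?_
  rw [pow_succ, pow_mul]
  ring

theorem muStar_le_of_charFun {N : ℕ} (a : Coeffs N) {w : ℂ} (hw : ‖w‖ < 1)
    (hre : (charFun a w).re = 0) (him : (charFun a w).im ≠ 0) :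
    muStar N a ≤ ENNReal.ofReal (1 / (charFun a w).im ^ 2) := by
  set y := (charFun a w).im with hy
  have hFy : charFun a w = y * I := by
    rw [← re_add_im (charFun a w), hre, ← hy]
    simp
  have hw0 : w ≠ 0 := by
    rintro rfl
    rw [charFun_zero] at hy
    exact him hy
  refine sSup_le fun m hm => ?_
  by_contra! hlt
  have hy2 : 0 < 1 / y ^ 2 := by positivity
  have hroot : IsCharRoot N a (-(1 / y ^ 2)) (w ^ 2)⁻¹ := by
    refine ⟨inv_ne_zero (pow_ne_zero 2 hw0), ?_⟩
    rw [inv_inv]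
    have h := charFun_eq_mul a w
    rw [hFy] at h
    set q := ∑ i : Fin N, (a i : ℂ) * (w ^ 2) ^ (i : ℕ) with hq
    have h2 : w ^ 2 * q ^ 2 = -(y : ℂ) ^ 2 := by
      rw [← mul_pow, ← h, mul_pow, I_sq]
      ring
    have hyC : (y : ℂ) ≠ 0 := ofReal_ne_zero.2 him
    push_cast
    field_simp
    linear_combination h2
  have h := hm (-(1 / y ^ 2)) (by linarith) (by rwa [neg_neg]) _ hroot
  rw [norm_inv, norm_pow] at h
  have h3 : ‖w‖ ^ 2 < 1 := pow_lt_one₀ (norm_nonneg _) hw two_ne_zero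
  have h4 : 0 < ‖w‖ ^ 2 := by positivity
  exact absurd ((one_lt_inv₀ h4).2 h3) (not_lt.2 h)

theorem muStar_lt_of_ne_optGains {N : ℕ} (hN : 1 ≤ N) {ε : Gains N} (hε : ε ≠ optGains N) :
    muStar N (coeffs N ε) < ENNReal.ofReal ((N : ℝ) ^ 2) := by
  have hN0 : (0 : ℝ) < N := by positivity
  obtain ⟨_, ⟨t, ht, rfl⟩, hlt⟩ := exists_lt_of_lt_csSup
    (Set.Nonempty.image _ ⟨Real.pi / 2, Or.inr rfl⟩) (rho_optGains_lt hN hε)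
  obtain ⟨w, hw, hre, him⟩ := exists_charFun_re_eq_zero _ ht hlt
  set y := (charFun (coeffs N ε) w).im with hy
  have hpos : 0 < |y| := lt_trans (by positivity) him
  refine (muStar_le_of_charFun _ hw hre (abs_pos.1 hpos)).trans_lt ?_
  rw [ENNReal.ofReal_lt_ofReal_iff (by positivity), ← hy, ← sq_abs, ← one_div_pow]
  refine pow_lt_pow_left₀ ?_ (by positivity) two_ne_zero
  rwa [one_div_lt hpos hN0]

section OptimalFunction

/-- The open right half of the unit disc. -/
def rightHalfDisc : Set ℂ := {z | 0 < z.re} ∩ Metric.ball 0 1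

theorem isOpen_rightHalfDisc : IsOpen rightHalfDisc :=
  (isOpen_lt continuous_const continuous_re).inter Metric.isOpen_ball

theorem ofReal_mem_rightHalfDisc {x : ℝ} (hx : x ∈ Set.Ioo (0 : ℝ) 1) :
    (x : ℂ) ∈ rightHalfDisc := by
  refine ⟨by simpa using hx.1, ?_⟩
  rw [mem_ball_zero_iff, norm_real, Real.norm_eq_abs, abs_of_pos hx.1]
  exact hx.2

theorem ofReal_mem_closure_rightHalfDisc {x : ℝ} (hx : x ∈ Set.Icc (0 : ℝ) 1) :
    (x : ℂ) ∈ closure rightHalfDisc := by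
  have h : x ∈ closure (Set.Ioo (0 : ℝ) 1) := by rwa [closure_Ioo zero_ne_one]
  exact map_mem_closure continuous_ofReal h fun y hy => ofReal_mem_rightHalfDisc hy

theorem charFun_optGains_re_nonneg_frontier {N : ℕ} (hN : 1 ≤ N) {z : ℂ}
    (hz : z ∈ frontier rightHalfDisc) : 0 ≤ (charFun (coeffs N (optGains N)) z).re := by
  rw [isOpen_rightHalfDisc.frontier_eq] at hz
  obtain ⟨hz, hz'⟩ := hz
  have h1 : 0 ≤ z.re := by
    have hcl : IsClosed {z : ℂ | 0 ≤ z.re} := isClosed_le continuous_const continuous_re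
    exact hcl.closure_subset_iff.2 (fun w hw => le_of_lt (show 0 < w.re from hw.1)) hz
  have h2 : ‖z‖ ≤ 1 := by
    have := Metric.isClosed_closedBall.closure_subset_iff.2
      (fun w (hw : w ∈ rightHalfDisc) => Metric.ball_subset_closedBall hw.2) hz
    rwa [mem_closedBall_zero_iff] at this
  rcases h1.eq_or_lt with h0 | hpos
  · have : z = z.im * I := by
      apply Complex.ext <;> simp [← h0]
    rw [this, charFun_ofReal_mul_I_re]
  · have hn : ‖z‖ = 1 := by
      refine le_antisymm h2 (not_lt.1 fun hlt => hz' ⟨hpos, ?_⟩)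
      rwa [mem_ball_zero_iff]
    have hza : exp (z.arg * I) = z := by
      have := norm_mul_exp_arg_mul_I z
      rwa [hn, ofReal_one, one_mul] at this
    rw [← hza, charFun_exp_re]
    refine cosPoly_optGains_nonneg hN ?_
    have := congrArg re hza
    rw [exp_ofReal_mul_I_re] at this
    rw [this]
    exact h1

/-- By the maximum principle for `exp (-F)`, `F` has positive real part on the right half disc. -/
theorem charFun_optGains_re_pos {N : ℕ} (hN : 1 ≤ N) {z : ℂ} (hz : z ∈ rightHalfDisc) :
    0 < (charFun (coeffs N (optGains N)) z).re := by
  set F := charFun (coeffs N (optGains N)) with hF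
  set E : ℂ → ℂ := fun z => exp (-F z) with hE
  have hnorm : ∀ z, ‖E z‖ = Real.exp (-(F z).re) := fun z => by rw [hE, norm_exp, neg_re]
  have hdiff : Differentiable ℂ E := by
    rw [hE, hF]
    unfold charFun
    fun_prop
  have hbdd : Bornology.IsBounded rightHalfDisc :=
    Metric.isBounded_ball.subset Set.inter_subset_right
  have hle : ∀ w ∈ closure rightHalfDisc, ‖E w‖ ≤ 1 := fun w hw =>
    norm_le_of_forall_mem_frontier_norm_le hbdd hdiff.diffContOnCl (fun u hu => by
      rw [hnorm, Real.exp_le_one_iff, neg_nonpos]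
      exact charFun_optGains_re_nonneg_frontier hN hu) hw
  by_contra! hneg
  have hEz : 1 ≤ ‖E z‖ := by
    rw [hnorm, Real.one_le_exp_iff]
    linarith
  have hmax : IsMaxOn (norm ∘ E) rightHalfDisc z := fun w hw =>
    (hle w (subset_closure hw)).trans hEz
  have hconv : Convex ℝ rightHalfDisc :=
    (convex_halfSpace_re_gt 0).inter (convex_ball 0 1)
  have heq := eqOn_closure_of_isPreconnected_of_isMaxOn_norm hconv.isPreconnected
    isOpen_rightHalfDisc hdiff.diffContOnCl hz hmax
  have h0 := heq (ofReal_mem_closure_rightHalfDisc ⟨le_rfl, zero_le_one⟩)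
  have h1 := heq (ofReal_mem_closure_rightHalfDisc ⟨zero_le_one, le_rfl⟩)
  have h01 := congrArg norm (h0.trans h1.symm)
  rw [hnorm, hnorm, ofReal_zero, ofReal_one, hF, charFun_zero,
    charFun_one (sum_coeffs_eq_one N hN _), Real.exp_eq_exp] at h01
  simp at h01

/-- The derivative of `charFun`. -/
noncomputable def charFunDeriv {N : ℕ} (a : Coeffs N) (w : ℂ) : ℂ :=
  ∑ i : Fin N, (a i : ℂ) * (((2 * (i : ℕ) + 1 : ℕ) : ℂ) * w ^ (2 * (i : ℕ)))

theorem hasDerivAt_charFun {N : ℕ} (a : Coeffs N) (w : ℂ) :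
    HasDerivAt (charFun a) (charFunDeriv a w) w := by
  unfold charFun charFunDeriv
  refine HasDerivAt.fun_sum fun i _ => ?_
  exact (hasDerivAt_pow (2 * (i : ℕ) + 1) w).const_mul (a i : ℂ)

theorem charFunDeriv_optGains_re_nonneg {N : ℕ} (hN : 1 ≤ N) {r : ℝ} (hr : |r| < 1) :
    0 ≤ (charFunDeriv (coeffs N (optGains N)) (r * I)).re := by
  set a := coeffs N (optGains N)
  have hd : HasDerivAt (fun w => charFun a (w + r * I)) (charFunDeriv a (r * I)) ((0 : ℝ) : ℂ) := by
    have h := hasDerivAt_charFun a (((0 : ℝ) : ℂ) + r * I)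
    rw [ofReal_zero, zero_add] at h
    exact HasDerivAt.comp_add_const _ _ (by simpa using h)
  have hlim := hd.real_of_complex.tendsto_slope_zero_right
  refine ge_of_tendsto hlim ?_
  filter_upwards [Ioo_mem_nhdsGT (show 0 < 1 - |r| by linarith)] with x hx
  have h0 : (charFun a (((0 : ℝ) : ℂ) + r * I)).re = 0 := by
    rw [ofReal_zero, zero_add, charFun_ofReal_mul_I_re]
  rw [h0, sub_zero, zero_add, smul_eq_mul]
  refine mul_nonneg (inv_nonneg.2 hx.1.le) (charFun_optGains_re_pos hN ⟨?_, ?_⟩).le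
  · simpa using hx.1
  · rw [mem_ball_zero_iff]
    refine (norm_add_le _ _).trans_lt ?_
    rw [norm_mul, norm_I, mul_one, norm_real, norm_real, Real.norm_eq_abs, Real.norm_eq_abs,
      abs_of_pos hx.1]
    linarith [hx.2]

theorem abs_charFun_optGains_im_le {N : ℕ} (hN : 1 ≤ N) {r : ℝ} (hr : |r| < 1) :
    |(charFun (coeffs N (optGains N)) (r * I)).im| ≤ 1 / N := by
  set a := coeffs N (optGains N) with ha
  set h : ℝ → ℝ := fun x => (charFun a (x * I)).im with hh
  have hd : ∀ x : ℝ, HasDerivAt h (charFunDeriv a (x * I)).re x := by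
    intro x
    have h1 : HasDerivAt (fun w => -I * charFun a (w * I)) (charFunDeriv a (x * I)) (x : ℂ) := by
      have h2 := ((hasDerivAt_charFun a (x * I)).comp (x : ℂ)
        ((hasDerivAt_id (x : ℂ)).mul_const I)).const_mul (-I)
      have h3 : -I * (charFunDeriv a (x * I) * (1 * I)) = charFunDeriv a (x * I) := by
        linear_combination (-charFunDeriv a (x * I)) * I_sq
      rw [h3] at h2
      exact h2
    convert h1.real_of_complex using 1
    funext y
    simp [hh]
  have hmono : MonotoneOn h (Set.Icc (-1) 1) := by
    refine monotoneOn_of_deriv_nonneg (convex_Icc _ _)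
      (fun x _ => (hd x).continuousAt.continuousWithinAt)
      (fun x _ => (hd x).differentiableAt.differentiableWithinAt) fun x hx => ?_
    rw [interior_Icc] at hx
    rw [(hd x).deriv]
    exact charFunDeriv_optGains_re_nonneg hN (abs_lt.2 hx)
  have h1 : h 1 = 1 / N := by
    simp only [hh, ofReal_one, one_mul]
    rw [charFun_I_im, ha, sinPoly_optGains_pi_div_two hN]
  have h2 : h (-1) = -(1 / N) := by
    rw [← h1]
    simp only [hh, ofReal_neg, ofReal_one, neg_mul, charFun_neg, neg_im]
  have hr' := abs_lt.1 hr
  rw [abs_le]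
  constructor
  · rw [← h2]
    exact hmono ⟨le_rfl, by norm_num⟩ ⟨hr'.1.le, hr'.2.le⟩ hr'.1.le
  · rw [← h1]
    exact hmono ⟨hr'.1.le, hr'.2.le⟩ ⟨by norm_num, le_rfl⟩ hr'.2.le

theorem abs_im_le_of_charFun_optGains_re_eq_zero {N : ℕ} (hN : 1 ≤ N) {w : ℂ} (hw : ‖w‖ < 1)
    (hre : (charFun (coeffs N (optGains N)) w).re = 0) :
    |(charFun (coeffs N (optGains N)) w).im| ≤ 1 / N := by
  rcases lt_trichotomy w.re 0 with h | h | h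
  · have := charFun_optGains_re_pos hN (z := -w)
      ⟨by simpa using h, by rw [mem_ball_zero_iff, norm_neg]; exact hw⟩
    rw [charFun_neg, neg_re, hre, neg_zero] at this
    exact absurd this (lt_irrefl 0)
  · have hwI : w = w.im * I := by
      apply Complex.ext <;> simp [h]
    rw [hwI]
    exact abs_charFun_optGains_im_le hN ((abs_im_le_norm w).trans_lt hw)
  · have := charFun_optGains_re_pos hN (z := w) ⟨h, by rwa [mem_ball_zero_iff]⟩
    exact absurd hre this.ne'

theorem le_muStar_optGains {N : ℕ} (hN : 1 ≤ N) :
    ENNReal.ofReal ((N : ℝ) ^ 2) ≤ muStar N (coeffs N (optGains N)) := by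
  have hN0 : (0 : ℝ) < N := by positivity
  refine le_sSup fun μ hμ hμN z hz => ?_
  rw [ENNReal.ofReal_lt_ofReal_iff (by positivity)] at hμN
  by_contra! hlt
  obtain ⟨hz0, hz⟩ := hz
  obtain ⟨w, hw⟩ := IsAlgClosed.exists_pow_nat_eq z⁻¹ two_pos
  have hw1 : ‖w‖ < 1 := by
    have h : ‖w‖ ^ 2 < 1 := by
      rw [← norm_pow, hw, norm_inv]
      exact inv_lt_one_of_one_lt₀ hlt
    exact (pow_lt_one_iff_of_nonneg (norm_nonneg _) two_ne_zero).1 h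
  set F := charFun (coeffs N (optGains N)) w with hF
  have hFsq : (μ : ℂ) * F ^ 2 = 1 := by
    rw [hF, charFun_eq_mul, mul_pow, hw, mul_left_comm, ← sub_eq_zero.1 hz, inv_mul_cancel₀ hz0]
  have hre := congrArg re hFsq
  have him := congrArg im hFsq
  rw [pow_two] at hre him
  simp only [mul_re, mul_im, ofReal_re, ofReal_im, zero_mul, sub_zero, add_zero, one_re,
    one_im] at hre him
  have hF0 : F.re = 0 := by
    have h1 : F.re * F.im = 0 := by
      have : μ * (F.re * F.im) = 0 := by linarith
      exact (mul_eq_zero.1 this).resolve_left hμ.ne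
    rcases mul_eq_zero.1 h1 with h | h
    · exact h
    · rw [h] at hre
      nlinarith [mul_self_nonneg F.re]
  have hle := abs_im_le_of_charFun_optGains_re_eq_zero hN hw1 hF0
  rw [← hF] at hle
  have h2 : F.im ^ 2 ≤ (1 / N) ^ 2 := sq_le_sq' (by linarith [(abs_le.1 hle).1]) (abs_le.1 hle).2
  rw [hF0] at hre
  have h3 : (N : ℝ) ^ 2 * F.im ^ 2 ≤ 1 := by
    rw [one_div_pow] at h2
    rw [mul_comm]
    exact (le_div_iff₀ (by positivity)).1 h2
  nlinarith [sq_nonneg F.im]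

end OptimalFunction

theorem muStar_lt_muStar_optGains {N : ℕ} (hN : 1 ≤ N) {ε : Gains N} (hε : ε ≠ optGains N) :
    muStar N (coeffs N ε) < muStar N (coeffs N (optGains N)) :=
  (muStar_lt_of_ne_optGains hN hε).trans_le (le_muStar_optGains hN)

end CharacteristicFunction

/-- A strict global maximizer in `s` is the unique maximizer on `s`. -/
theorem mem_and_isMaxOn_iff_of_lt {α β : Type*} [LinearOrder β] {g : α → β} {s : Set α} {x₀ : α}
    (h₀ : x₀ ∈ s) (h : ∀ x, x ≠ x₀ → g x < g x₀) (x : α) :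
    (x ∈ s ∧ IsMaxOn g s x) ↔ x = x₀ := by
  constructor
  · rintro ⟨-, hmax⟩
    by_contra hne
    exact absurd (hmax h₀) (not_le.2 (h x hne))
  · rintro rfl
    refine ⟨h₀, fun y _ => ?_⟩
    rcases eq_or_ne y x with rfl | hne
    · exact le_refl (g y)
    · exact (h y hne).le

end CycleControl

theorem corollary2 (N : ℕ) (hN : 1 ≤ N) :
    -- the system closed by the control is `x_{n+1} = ∑ a_j f(x_{n-2j+2})`
    (∀ (ε : CycleControl.Gains N) (f : ℝ → ℝ) (x : ℤ → ℝ) (n : ℤ),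
      f (x n) + CycleControl.control N ε f x n =
        ∑ i : Fin N, CycleControl.coeffs N ε i * f (x (n - 2 * ((i : ℤ) + 1) + 2))) ∧
    -- gains and normalized coefficients correspond bijectively
    Set.BijOn (CycleControl.coeffs N) Set.univ {a : CycleControl.Coeffs N | ∑ i, a i = 1} ∧
    -- the unique admissible gains that maximize `μ*`
    (∀ ε : CycleControl.Gains N,
      (ε ∈ CycleControl.admissible N ∧
        IsMaxOn (fun e => CycleControl.muStar N (CycleControl.coeffs N e))
          (CycleControl.admissible N) ε) ↔ ε = CycleControl.optGains N) ∧
    -- they are the unique maximizer among all real gains as well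
    (∀ ε : CycleControl.Gains N,
      IsMaxOn (fun e => CycleControl.muStar N (CycleControl.coeffs N e)) Set.univ ε ↔
        ε = CycleControl.optGains N) ∧
    -- and the unique solution of the extremal problem for the conjugate polynomials `C`, `S`
    (∀ ε : CycleControl.Gains N,
      IsMinOn (fun e => CycleControl.rho N (CycleControl.coeffs N e)) Set.univ ε ↔
        ε = CycleControl.optGains N) := by
  have hμ := fun ε hε => CycleControl.muStar_lt_muStar_optGains (ε := ε) hN hε
  refine ⟨CycleControl.add_control_eq N hN, CycleControl.bijOn_coeffs N hN,
    CycleControl.mem_and_isMaxOn_iff_of_lt (CycleControl.optGains_mem_admissible hN) hμ,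
    fun ε => ?_, fun ε => ?_⟩
  · simpa using CycleControl.mem_and_isMaxOn_iff_of_lt (Set.mem_univ _) hμ ε
  · have hρ : ∀ e, e ≠ CycleControl.optGains N → OrderDual.toDual
        (CycleControl.rho N (CycleControl.coeffs N e)) < OrderDual.toDual
        (CycleControl.rho N (CycleControl.coeffs N (CycleControl.optGains N))) := fun e he => by
      rw [OrderDual.toDual_lt_toDual, CycleControl.rho_optGains hN]
      exact CycleControl.rho_optGains_lt hN he
    rw [← isMaxOn_dual_iff]
    simpa [Function.comp_def] using
      CycleControl.mem_and_isMaxOn_iff_of_lt (Set.mem_univ _) hρ ε
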